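/- **Setting.** Let $d\in\mathbb N$ and let $\mathcal F:\ell^2(\mathbb Z)\otimes\mathbb C^d\to L^2(\mathbb T)\otimes\mathbb C^d$, $\mathbb T=\mathbb R/2\pi\mathbb Z$, be the Fourier transform $1_{\{k\}}\otimes v\mapsto \frac{1}{\sqrt{2\pi}}e^{ikx}\otimes v$. Let $Q,R$ be bounded operators on $\ell^2(\mathbb Z)\otimes\mathbb C^d$ with $0\le Q\le I$, $0\le R\le I$ that are translation-invariant with symbol functions $q,r\in L^\infty(\mathbb T,\mathcal B(\mathbb C^d))$, i.e. $Q=\mathcal F^{-1}M_q\mathcal F$ and $R=\mathcal F^{-1}M_r\mathcal F$, where $M_q,M_r$ are the multiplication operators. For $n\in\mathbb N$ let $Q_n,R_n$ be the compressions of $Q,R$ to $\mathcal H_n=\ell^2(\{0,\dots,n-1\})\otimes\mathbb C^d$. For an operator $0\le G\le I$ on $\mathcal H_n$ let $\widehat\omega_G$ be the density operator on the fermionic Fock space over $\mathcal H_n$ of the gauge-invariant quasi-free state with symbol $G$, i.e. the unique state with $$\omega_G\big(a(\phi_1)^*\cdots a(\phi_k)^*a(\psi_m)\cdots a(\psi_1)\big)=\delta_{km}\det\big(\langle\psi_i,G\phi_j\rangle\big)_{i,j=1}^k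 .$$ Assume that there is an interval $[\mu,\nu]\subset[0,2\pi)$ with $\mu<\nu$ on which $q$ and $r$ are Lipschitz continuous, and that one of the following holds: 1. for every $x\in[\mu,\nu]$, $q(x)r(x)=0$ and $r(x)$ is a non-zero orthogonal projection; 2. for every $x\in[\mu,\nu]$, $(I-q(x))(I-r(x))=0$ and $I-q(x)$ is a non-zero orthogonal projection. For $\delta\in(0,(\nu-\mu)/2)$ and $n\in\mathbb N$ put $\theta_k=2\pi k/n$, let $F_n1_{\{k\}}=n^{-1/2}\sum_{j=0}^{n-1}e^{2\pi ijk/n}1_{\{j\}}$ be the discrete Fourier transform on $\ell^2(\{0,\dots,n-1\})$, and let $$E_{n,\delta}=(F_n\otimes I)^*\Big(\sum_{0\le k<n,\ \theta_k\in[\mu+\delta,\nu-\delta]}|1_{\{k\}}\rangle\langle 1_{\{k\}}|\otimes\{r(\theta_k)-q(\theta_k)>0\}\Big)(F_n\otimes I),$$ where $\{A>0\}$ is the sum of the spectral projections of $A$ for its positive eigenvalues. Let $T_{n,\delta}$ be the spectral projection of the number operator $N_{E_{n,\delta}}=\sum_k a(e_k)^*a(e_k)$, with $(e_k)$ an orthonormal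 basis of $\operatorname{ran}E_{n,\delta}$, for the eigenvalues $0,1,\dots,\lfloor \operatorname{Tr}E_{n,\delta}/2\rfloor$. **Theorem (super-exponential discrimination).** For every $\delta\in(0,(\nu-\mu)/2)$ there is a constant $c>0$ such that for every large enough $n$ $$\operatorname{Tr}\widehat\omega_{Q_n}(I-T_{n,\delta})\le e^{-cn\log n},\qquad \operatorname{Tr}\widehat\omega_{R_n}T_{n,\delta}\le e^{-cn\log n}.$$ In particular, the two states can be super-exponentially discriminated: there are operators $0\le T_n\le I$ on the Fock spaces over $\mathcal H_n$, $n\in\mathbb N$, such that $$\lim_{n\to\infty}-\frac1n\log\operatorname{Tr}\widehat\omega_{Q_n}(I-T_n)=+\infty=\lim_{n\to\infty}-\frac1n\log\operatorname{Tr}\widehat\omega_{R_n}T_n ,\qquad \log 0:=-\infty .$$ -/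

import Mathlib

open Filter Topology MeasureTheory AddCircle
open scoped InnerProductSpace Kronecker

set_option linter.unusedSectionVars false

noncomputable section

/-- The trace of a bounded operator on a (finite-dimensional) Hilbert space. -/
def opTrace {E : Type*} [NormedAddCommGroup E] [InnerProductSpace ℂ E] (A : E →L[ℂ] E) : ℂ :=
  LinearMap.trace ℂ E A.toLinearMap

section Wick

variable {H E : Type*} [NormedAddCommGroup H] [InnerProductSpace ℂ H]
  [NormedAddCommGroup E] [InnerProductSpace ℂ E] 

lemma opTrace_add (A B : E →L[ℂ] E) : opTrace (A + B) = opTrace A + opTrace B := by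
  simp [opTrace]

lemma opTrace_smul (z : ℂ) (A : E →L[ℂ] E) : opTrace (z • A) = z * opTrace A := by
  simp [opTrace]

lemma opTrace_sub (A B : E →L[ℂ] E) : opTrace (A - B) = opTrace A - opTrace B := by
  simp [opTrace]

lemma opTrace_mul_comm (A B : E →L[ℂ] E) : opTrace (A * B) = opTrace (B * A) :=
  LinearMap.trace_mul_comm ℂ A.toLinearMap B.toLinearMap

lemma opTrace_sum {κ : Type*} (s : Finset κ) (A : κ → E →L[ℂ] E) :
    opTrace (∑ i ∈ s, A i) = ∑ i ∈ s, opTrace (A i) := by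
  classical
  induction s using Finset.induction_on with
  | empty => simp [opTrace]
  | insert i s hi ih => rw [Finset.sum_insert hi, Finset.sum_insert hi, opTrace_add, ih]

variable [CompleteSpace E]

/-- The product `c(φ₁) ⋯ c(φₙ)`, where `c(φ)` are the creation operators. -/
def creationProd (c : H →ₗ[ℂ] (E →L[ℂ] E)) {n : ℕ} (φ : Fin n → H) : E →L[ℂ] E :=
  (List.ofFn fun i => c (φ i)).prod

/-- The product `a(ψₙ) ⋯ a(ψ₁)`, where `a(ψ) = c(ψ)*` are the annihilation operators. -/
def annihilationProd (c : H →ₗ[ℂ] (E →L[ℂ] E)) {n : ℕ} (ψ : Fin n → H) : E →L[ℂ] E :=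
  (List.ofFn fun i => ContinuousLinearMap.adjoint (c (ψ i))).reverse.prod

/-- The canonical anticommutation relations for the creation operators `c(φ)` and their adjoints. -/
def IsCAR (c : H →ₗ[ℂ] (E →L[ℂ] E)) : Prop :=
  (∀ φ ψ, c φ * c ψ = - (c ψ * c φ)) ∧
  ∀ φ ψ, ContinuousLinearMap.adjoint (c φ) * c ψ =
    ⟪φ, ψ⟫_ℂ • 1 - c ψ * ContinuousLinearMap.adjoint (c φ)

variable {c : H →ₗ[ℂ] (E →L[ℂ] E)}

lemma creationProd_zero (φ : Fin 0 → H) : creationProd c φ = 1 := by simp [creationProd]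

lemma annihilationProd_zero (φ : Fin 0 → H) : annihilationProd c φ = 1 := by
  simp [annihilationProd]

lemma creationProd_succ {n : ℕ} (φ : Fin (n + 1) → H) :
    creationProd c φ = c (φ 0) * creationProd c (fun i : Fin n => φ i.succ) := by
  simp [creationProd, List.ofFn_succ]

lemma annihilationProd_succ {n : ℕ} (φ : Fin (n + 1) → H) :
    annihilationProd c φ = annihilationProd c (fun i : Fin n => φ i.succ) * ContinuousLinearMap.adjoint (c (φ 0)) := by
  simp [annihilationProd, List.ofFn_succ]

lemma creationProd_mul (hc : IsCAR c) {n : ℕ} (φ : Fin n → H) (f : H) :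
    creationProd c φ * c f = (-1 : ℂ) ^ n • (c f * creationProd c φ) := by
  induction n with
  | zero => simp [creationProd_zero]
  | succ n ih =>
    rw [creationProd_succ, mul_assoc, ih, mul_smul_comm, ← mul_assoc, hc.1 (φ 0) f, pow_succ,
      mul_smul, neg_mul, mul_assoc]
    simp

lemma annihilationProd_mul (hc : IsCAR c) {n : ℕ} (ψ : Fin (n + 1) → H) (f : H) :
    annihilationProd c ψ * c f =
      ∑ i : Fin (n + 1), ((-1 : ℂ) ^ (i : ℕ) * ⟪ψ i, f⟫_ℂ) •
          annihilationProd c (fun k => ψ (i.succAbove k)) +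
        (-1 : ℂ) ^ (n + 1) • (c f * annihilationProd c ψ) := by
  induction n with
  | zero =>
    simp [annihilationProd_succ, annihilationProd_zero, hc.2, sub_eq_add_neg]
  | succ n ih =>
    rw [annihilationProd_succ, mul_assoc, hc.2, mul_sub, ← mul_assoc (annihilationProd c _), ih,
      Fin.sum_univ_succ (n := n + 1)]
    have h : ∀ i : Fin (n + 1), annihilationProd c (fun k => ψ (i.succ.succAbove k)) =
        annihilationProd c (fun k => ψ (i.succAbove k).succ) * ContinuousLinearMap.adjoint (c (ψ 0)) := by
      intro i
      rw [annihilationProd_succ]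
      simp
    simp only [h, add_mul, Finset.sum_mul, smul_mul_assoc, mul_smul_comm, mul_one, Fin.val_zero,
      Fin.val_succ, pow_succ, pow_zero, one_mul, Fin.succAbove_zero, mul_neg, neg_mul, neg_smul,
      Finset.sum_neg_distrib, mul_assoc, neg_neg]
    abel

section Basis

variable {m : ℕ} (b : OrthonormalBasis (Fin m) ℂ H) (q : Fin m → ℝ)

/-- The number operator of the mode `b j`. -/
def modeNumber (c : H →ₗ[ℂ] (E →L[ℂ] E)) (b : OrthonormalBasis (Fin m) ℂ H) (j : Fin m) :
    E →L[ℂ] E := c (b j) * ContinuousLinearMap.adjoint (c (b j))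

/-- `q_j a(b_j)* a(b_j) + (1 - q_j) a(b_j) a(b_j)*`. -/
def modeFactor (c : H →ₗ[ℂ] (E →L[ℂ] E)) (b : OrthonormalBasis (Fin m) ℂ H) (q : Fin m → ℝ)
    (j : Fin m) : E →L[ℂ] E :=
  (q j : ℂ) • modeNumber c b j + (1 - q j : ℂ) • (1 - modeNumber c b j)

lemma c_sq (hc : IsCAR c) (φ : H) : c φ * c φ = 0 := by
  have h := hc.1 φ φ
  have h2 : (2 : ℂ) • (c φ * c φ) = 0 := by
    rw [two_smul]
    nth_rewrite 1 [h]
    exact neg_add_cancel _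
  exact (smul_eq_zero.mp h2).resolve_left two_ne_zero

lemma modeNumber_mul (hc : IsCAR c) (j : Fin m) (φ : H) :
    modeNumber c b j * c φ = ⟪b j, φ⟫_ℂ • c (b j) + c φ * modeNumber c b j := by
  rw [modeNumber, mul_assoc, hc.2, mul_sub, ← mul_assoc, hc.1 (b j) φ]
  simp [mul_assoc]

lemma adjoint_modeNumber (j : Fin m) : ContinuousLinearMap.adjoint (modeNumber c b j) = modeNumber c b j := by
  rw [modeNumber, ← ContinuousLinearMap.star_eq_adjoint, ← ContinuousLinearMap.star_eq_adjoint,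
    star_mul, star_star]

lemma commute_modeNumber (hc : IsCAR c) {i j : Fin m} (hij : i ≠ j) :
    Commute (modeNumber c b i) (c (b j)) := by
  have h := modeNumber_mul b hc i (b j)
  rw [b.inner_eq_zero hij, zero_smul, zero_add] at h
  exact h

lemma commute_modeNumber' (hc : IsCAR c) {i j : Fin m} (hij : i ≠ j) :
    Commute (modeNumber c b i) (ContinuousLinearMap.adjoint (c (b j))) := by
  have h := congrArg star (commute_modeNumber b hc hij).eq
  rw [star_mul, star_mul] at h
  simp only [ContinuousLinearMap.star_eq_adjoint, adjoint_modeNumber] at h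
  exact h.symm

lemma commute_modeNumber_modeNumber (hc : IsCAR c) (i j : Fin m) :
    Commute (modeNumber c b i) (modeNumber c b j) := by
  rcases eq_or_ne i j with rfl | hij
  · exact Commute.refl _
  · exact (commute_modeNumber b hc hij).mul_right (commute_modeNumber' b hc hij)

lemma commute_modeFactor {i : Fin m} {X : E →L[ℂ] E} (h : Commute (modeNumber c b i) X) :
    Commute (modeFactor c b q i) X :=
  (h.smul_left _).add_left (((Commute.one_left X).sub_left h).smul_left _)

lemma modeFactor_mul (hc : IsCAR c) (j : Fin m) :
    modeFactor c b q j * c (b j) = (q j : ℂ) • c (b j) := by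
  have h : modeNumber c b j * c (b j) = c (b j) := by
    rw [modeNumber_mul b hc, modeNumber, ← mul_assoc, c_sq hc, zero_mul, add_zero]
    simp
  simp only [modeFactor, add_mul, smul_mul_assoc, sub_mul, h, one_mul, sub_self, smul_zero,
    add_zero]

lemma mul_modeFactor (hc : IsCAR c) (j : Fin m) :
    c (b j) * modeFactor c b q j = (1 - q j : ℂ) • c (b j) := by
  have h : c (b j) * modeNumber c b j = 0 := by
    rw [modeNumber, ← mul_assoc, c_sq hc, zero_mul]
  simp only [modeFactor, mul_add, mul_smul_comm, mul_sub, h, mul_one, sub_zero, smul_zero,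
    zero_add]

lemma modeFactor_nonneg (hc : IsCAR c) (hq0 : ∀ j, 0 ≤ q j) (hq1 : ∀ j, q j ≤ 1) (j : Fin m) :
    0 ≤ modeFactor c b q j := by
  have h0 : 0 ≤ modeNumber c b j := mul_star_self_nonneg (c (b j))
  have h1 : 0 ≤ 1 - modeNumber c b j := by
    have : 1 - modeNumber c b j = star (c (b j)) * c (b j) := by
      rw [ContinuousLinearMap.star_eq_adjoint, hc.2, modeNumber]
      simp
    rw [this]
    exact star_mul_self_nonneg _
  rw [ContinuousLinearMap.nonneg_iff_isPositive] at *
  refine (h0.smul_of_nonneg (Complex.zero_le_real.mpr (hq0 j))).add (h1.smul_of_nonneg ?_)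
  rw [← Complex.ofReal_one, ← Complex.ofReal_sub]
  exact Complex.zero_le_real.mpr (sub_nonneg.mpr (hq1 j))

/-- The product of the factors `modeFactor` over a list of modes. -/
def factorProd (c : H →ₗ[ℂ] (E →L[ℂ] E)) (b : OrthonormalBasis (Fin m) ℂ H) (q : Fin m → ℝ)
    (l : List (Fin m)) : E →L[ℂ] E := (l.map (modeFactor c b q)).prod

lemma commute_factorProd {l : List (Fin m)} {X : E →L[ℂ] E}
    (h : ∀ i ∈ l, Commute (modeNumber c b i) X) : Commute (factorProd c b q l) X := by
  refine Commute.list_prod_left _ _ ?_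
  intro y hy
  obtain ⟨i, hi, rfl⟩ := List.mem_map.mp hy
  exact commute_modeFactor b q (h i hi)

lemma factorProd_cons (j : Fin m) (l : List (Fin m)) :
    factorProd c b q (j :: l) = modeFactor c b q j * factorProd c b q l := by
  simp [factorProd]

lemma factorProd_nonneg (hc : IsCAR c) (hq0 : ∀ j, 0 ≤ q j) (hq1 : ∀ j, q j ≤ 1)
    (l : List (Fin m)) : 0 ≤ factorProd c b q l := by
  induction l with
  | nil => simp [factorProd]
  | cons j l ih =>
    rw [factorProd_cons]
    refine Commute.mul_nonneg (modeFactor_nonneg b q hc hq0 hq1 j) ih ?_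
    refine (commute_factorProd b q fun i _ => ?_).symm
    exact (commute_modeFactor b q (commute_modeNumber_modeNumber b hc j i)).symm

lemma opTrace_factorProd (hc : IsCAR c) {l : List (Fin m)} (hl : l.Nodup) :
    opTrace (factorProd c b q l) = opTrace (1 : E →L[ℂ] E) / 2 ^ l.length := by
  induction l with
  | nil => simp [factorProd]
  | cons j l ih =>
    obtain ⟨hj, hl⟩ := List.nodup_cons.mp hl
    have hne : ∀ i ∈ l, i ≠ j := fun i hi h => hj (h ▸ hi)
    have h1 : Commute (factorProd c b q l) (c (b j)) :=
      commute_factorProd b q fun i hi => commute_modeNumber b hc (hne i hi)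
    have h3 : opTrace (modeNumber c b j * factorProd c b q l) =
        opTrace (factorProd c b q l) - opTrace (modeNumber c b j * factorProd c b q l) := by
      conv_lhs => rw [modeNumber, mul_assoc, opTrace_mul_comm, mul_assoc, h1.eq, ← mul_assoc, hc.2]
      rw [← modeNumber, sub_mul, opTrace_sub]
      simp
    rw [factorProd_cons, modeFactor, add_mul, smul_mul_assoc, smul_mul_assoc, sub_mul, one_mul,
      opTrace_add, opTrace_smul, opTrace_smul, opTrace_sub, List.length_cons, pow_succ]
    have h4 := ih hl
    rw [← div_div, ← h4]
    linear_combination (q j - 1 / 2 : ℂ) * h3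

lemma factorProd_mul (hc : IsCAR c) {l : List (Fin m)} (hl : l.Nodup) {j : Fin m} (hj : j ∈ l) :
    (1 - q j : ℂ) • (factorProd c b q l * c (b j)) = (q j : ℂ) • (c (b j) * factorProd c b q l) := by
  induction l with
  | nil => simp at hj
  | cons i l ih =>
    obtain ⟨hi, hl⟩ := List.nodup_cons.mp hl
    rw [factorProd_cons]
    rcases eq_or_ne i j with rfl | hij
    · have h1 : Commute (factorProd c b q l) (c (b i)) :=
        commute_factorProd b q fun k hk => commute_modeNumber b hc fun h => hi (h ▸ hk)
      rw [mul_assoc, h1.eq, ← mul_assoc, ← mul_assoc, modeFactor_mul b q hc, mul_modeFactor b q hc,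
        smul_mul_assoc, smul_mul_assoc, smul_smul, smul_smul, mul_comm]
    · have hj' : j ∈ l := by
        rcases List.mem_cons.mp hj with h | h
        · exact absurd h.symm hij
        · exact h
      have h2 := commute_modeFactor b q (commute_modeNumber b hc hij)
      rw [mul_assoc, ← mul_smul_comm, ih hl hj', mul_smul_comm, ← mul_assoc, ← mul_assoc, h2.eq]

lemma wick_mode (hc : IsCAR c) (j : Fin m) (X : E →L[ℂ] E) :
    opTrace (factorProd c b q (List.finRange m) * (c (b j) * X)) =
      q j * opTrace (factorProd c b q (List.finRange m) * (X * c (b j) + c (b j) * X)) := by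
  have h := congrArg (fun Y => opTrace (Y * X))
    (factorProd_mul b q hc (List.nodup_finRange m) (List.mem_finRange j))
  simp only [smul_mul_assoc, opTrace_smul] at h
  rw [mul_assoc (c (b j)), opTrace_mul_comm (c (b j)), mul_assoc, mul_assoc] at h
  rw [mul_add, opTrace_add]
  linear_combination h

lemma anticomm_prod (hc : IsCAR c) {n : ℕ} (φ : Fin n → H) (ψ : Fin (n + 1) → H) (f : H) :
    creationProd c φ * annihilationProd c ψ * c f + c f * (creationProd c φ * annihilationProd c ψ) =
      ∑ i : Fin (n + 1), ((-1 : ℂ) ^ (i : ℕ) * ⟪ψ i, f⟫_ℂ) •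
          (creationProd c φ * annihilationProd c (fun k => ψ (i.succAbove k))) := by
  rw [mul_assoc, annihilationProd_mul hc, mul_add, mul_smul_comm, ← mul_assoc, creationProd_mul hc,
    smul_mul_assoc, smul_smul, Finset.mul_sum]
  have : (-1 : ℂ) ^ (n + 1) * (-1) ^ n = -1 := by
    rw [← pow_add, show n + 1 + n = 2 * n + 1 by ring, pow_succ, pow_mul]; simp
  rw [this]
  simp [mul_assoc]

lemma wick_det (hc : IsCAR c) (Q : H →L[ℂ] H) (hQ : ∀ j, Q (b j) = (q j : ℂ) • b j) (n : ℕ)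
    (φ ψ : Fin n → H) :
    opTrace (factorProd c b q (List.finRange m) * (creationProd c φ * annihilationProd c ψ)) =
      opTrace (factorProd c b q (List.finRange m)) *
        (Matrix.of fun i j => ⟪ψ i, Q (φ j)⟫_ℂ).det := by
  induction n with
  | zero => simp [creationProd_zero, annihilationProd_zero]
  | succ n ih =>
    have key : ∀ j, opTrace (factorProd c b q (List.finRange m) *
        (c (b j) * (creationProd c (fun i : Fin n => φ i.succ) * annihilationProd c ψ))) =
        ∑ i : Fin (n + 1), ((-1 : ℂ) ^ (i : ℕ) * ⟪ψ i, Q (b j)⟫_ℂ) *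
          opTrace (factorProd c b q (List.finRange m) *
            (creationProd c (fun i : Fin n => φ i.succ) *
              annihilationProd c (fun k => ψ (i.succAbove k)))) := by
      intro j
      rw [wick_mode b q hc, anticomm_prod hc, Finset.mul_sum, opTrace_sum, Finset.mul_sum]
      refine Finset.sum_congr rfl fun i _ => ?_
      rw [mul_smul_comm, opTrace_smul, hQ, inner_smul_right]
      ring
    have hlin : ∀ f : H, opTrace (factorProd c b q (List.finRange m) *
        (c f * (creationProd c (fun i : Fin n => φ i.succ) * annihilationProd c ψ))) =
        ∑ i : Fin (n + 1), ((-1 : ℂ) ^ (i : ℕ) * ⟪ψ i, Q f⟫_ℂ) *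
          opTrace (factorProd c b q (List.finRange m) *
            (creationProd c (fun i : Fin n => φ i.succ) *
              annihilationProd c (fun k => ψ (i.succAbove k)))) := by
      intro f
      have hf := b.sum_repr f
      conv_lhs => rw [← hf]
      conv_rhs => rw [← hf]
      simp only [map_sum, map_smul, Finset.sum_mul, Finset.mul_sum, smul_mul_assoc, mul_smul_comm,
        opTrace_sum, opTrace_smul, key, inner_sum, inner_smul_right]
      rw [Finset.sum_comm]
      refine Finset.sum_congr rfl fun i _ => Finset.sum_congr rfl fun j _ => ?_
      ring
    rw [creationProd_succ, mul_assoc, hlin, Matrix.det_succ_column_zero, Finset.mul_sum]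
    refine Finset.sum_congr rfl fun i _ => ?_
    rw [ih]
    have : (Matrix.of fun i j => ⟪ψ i, Q (φ j)⟫_ℂ).submatrix i.succAbove Fin.succ =
      Matrix.of fun k j : Fin n => ⟪ψ (i.succAbove k), Q (φ j.succ)⟫_ℂ := rfl
    rw [this, Matrix.of_apply]
    ring

lemma sum_modeNumber_mul (hc : IsCAR c) (φ : H) :
    (∑ j, modeNumber c b j) * c φ = c φ * (∑ j, modeNumber c b j) + c φ := by
  simp only [Finset.sum_mul, Finset.mul_sum, modeNumber_mul b hc, Finset.sum_add_distrib]
  rw [add_comm]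
  congr 1
  conv_rhs => rw [← b.sum_repr' φ]
  simp only [map_sum, map_smul]

lemma sum_modeNumber_mul_adjoint (hc : IsCAR c) (φ : H) :
    (∑ j, modeNumber c b j) * ContinuousLinearMap.adjoint (c φ) = ContinuousLinearMap.adjoint (c φ) * (∑ j, modeNumber c b j) - ContinuousLinearMap.adjoint (c φ) := by
  have h := congrArg star (sum_modeNumber_mul b hc φ)
  have hs : star (∑ j, modeNumber c b j) = ∑ j, modeNumber c b j := by
    rw [star_sum]
    exact Finset.sum_congr rfl fun j _ => adjoint_modeNumber b j
  rw [star_add, star_mul, star_mul, hs, ContinuousLinearMap.star_eq_adjoint] at h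
  rw [h]; abel

lemma sum_modeNumber_mul_creationProd (hc : IsCAR c) {n : ℕ} (φ : Fin n → H) :
    (∑ j, modeNumber c b j) * creationProd c φ =
      creationProd c φ * (∑ j, modeNumber c b j) + (n : ℂ) • creationProd c φ := by
  induction n with
  | zero => simp [creationProd_zero]
  | succ n ih =>
    rw [creationProd_succ, ← mul_assoc, sum_modeNumber_mul b hc, add_mul, mul_assoc, ih, mul_add,
      mul_smul_comm, Nat.cast_succ, add_smul, one_smul, mul_assoc, add_assoc]

lemma sum_modeNumber_mul_annihilationProd (hc : IsCAR c) {n : ℕ} (φ : Fin n → H) :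
    (∑ j, modeNumber c b j) * annihilationProd c φ =
      annihilationProd c φ * (∑ j, modeNumber c b j) - (n : ℂ) • annihilationProd c φ := by
  induction n with
  | zero => simp [annihilationProd_zero]
  | succ n ih =>
    rw [annihilationProd_succ, ← mul_assoc, ih, sub_mul, mul_assoc,
      sum_modeNumber_mul_adjoint b hc, mul_sub, smul_mul_assoc, Nat.cast_succ, add_smul, one_smul,
      mul_assoc]
    abel

lemma wick_ne (hc : IsCAR c) {k l : ℕ} (hkl : k ≠ l) (φ : Fin k → H) (ψ : Fin l → H) :
    opTrace (factorProd c b q (List.finRange m) * (creationProd c φ * annihilationProd c ψ)) = 0 := by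
  set N := ∑ j, modeNumber c b j with hN
  set X := creationProd c φ * annihilationProd c ψ with hX
  have h1 : N * X = X * N + ((k : ℂ) - l) • X := by
    rw [hX, ← mul_assoc, sum_modeNumber_mul_creationProd b hc, add_mul, mul_assoc,
      sum_modeNumber_mul_annihilationProd b hc, mul_sub, smul_mul_assoc, mul_smul_comm, sub_smul,
      mul_assoc]
    abel
  have h2 : Commute (factorProd c b q (List.finRange m)) N := by
    refine commute_factorProd b q fun i _ => ?_
    exact Commute.sum_right _ _ _ fun j _ => commute_modeNumber_modeNumber b hc i j
  have h3 : opTrace (factorProd c b q (List.finRange m) * (N * X)) =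
      opTrace (factorProd c b q (List.finRange m) * (X * N)) := by
    rw [← mul_assoc, h2.eq, mul_assoc, opTrace_mul_comm, mul_assoc]
  rw [h1, mul_add, opTrace_add, mul_smul_comm, opTrace_smul, add_eq_left] at h3
  refine (mul_eq_zero.mp h3).resolve_left ?_
  rw [sub_eq_zero]
  exact_mod_cast hkl

end Basis
end Wick

section FermionicFockSpace

variable {ι : Type*} [Fintype ι] [LinearOrder ι]

/-- The fermionic Fock space `⨁ₖ ℋ^{∧k}` over `ℋ = ℓ²(ι)`, with `ι` finite and linearly ordered, in the
occupation number representation: the basis vector of `S = {i₁ < ⋯ < iₖ}` is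
`e_{i₁} ∧ ⋯ ∧ e_{iₖ} ∈ ℋ^{∧k}`. -/
def Fock (ι : Type*) : Type _ := EuclideanSpace ℂ (Finset ι)

instance : NormedAddCommGroup (Fock ι) :=
  inferInstanceAs (NormedAddCommGroup (EuclideanSpace ℂ (Finset ι)))

instance : InnerProductSpace ℂ (Fock ι) :=
  inferInstanceAs (InnerProductSpace ℂ (EuclideanSpace ℂ (Finset ι)))

instance : FiniteDimensional ℂ (Fock ι) :=
  inferInstanceAs (FiniteDimensional ℂ (EuclideanSpace ℂ (Finset ι)))

instance : CompleteSpace (Fock ι) :=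
  inferInstanceAs (CompleteSpace (EuclideanSpace ℂ (Finset ι)))

/-- The orthonormal basis `e_S = e_{i₁} ∧ ⋯ ∧ e_{iₖ}`, `S = {i₁ < ⋯ < iₖ}`, of the Fock space. -/
def slater : OrthonormalBasis (Finset ι) ℂ (Fock ι) := EuclideanSpace.basisFun (Finset ι) ℂ

/-- The sign in `e_i ∧ e_S = ± e_{S ∪ {i}}`, for `i ∉ S`. -/
def fockSign (i : ι) (S : Finset ι) : ℂ := (-1) ^ (S.filter (· < i)).card

/-- The creation operator of the mode `e_i`, given by `e_S ↦ e_i ∧ e_S`. -/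
def modeCreation (i : ι) : Fock ι →L[ℂ] Fock ι :=
  LinearMap.toContinuousLinearMap (slater.toBasis.constr ℂ fun S =>
    if i ∈ S then 0 else fockSign i S • slater (insert i S))

/-- The creation operator `c(φ) : x ↦ φ ∧ x`, as a linear function of `φ`. -/
def creation : EuclideanSpace ℂ ι →ₗ[ℂ] (Fock ι →L[ℂ] Fock ι) where
  toFun φ := ∑ i, φ i • modeCreation i
  map_add' φ ψ := by simp [add_smul, Finset.sum_add_distrib]
  map_smul' z φ := by simp [mul_smul, Finset.smul_sum]

/-- The annihilation operator `a(φ) = c(φ)*`. -/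
def annihilation (φ : EuclideanSpace ℂ ι) : Fock ι →L[ℂ] Fock ι :=
  ContinuousLinearMap.adjoint (creation φ)

lemma modeCreation_slater (i : ι) (S : Finset ι) :
    modeCreation i (slater S) = if i ∈ S then 0 else fockSign i S • slater (insert i S) := by
  simp only [modeCreation, LinearMap.coe_toContinuousLinearMap']
  rw [← OrthonormalBasis.coe_toBasis, Module.Basis.constr_basis]

lemma fockSign_mul_self (i : ι) (S : Finset ι) : fockSign i S * fockSign i S = 1 := by
  unfold fockSign
  rw [← pow_add, ← two_mul, pow_mul]; simp

lemma fockSign_insert_self (i : ι) (S : Finset ι) : fockSign i (insert i S) = fockSign i S := by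
  unfold fockSign
  simp [Finset.filter_insert]

lemma fockSign_erase_self (i : ι) (S : Finset ι) : fockSign i (S.erase i) = fockSign i S := by
  unfold fockSign
  rw [Finset.filter_erase, Finset.erase_eq_of_notMem]; simp

lemma fockSign_insert {i j : ι} {S : Finset ι} (hj : j ∉ S) :
    fockSign i (insert j S) = (if j < i then -1 else 1) * fockSign i S := by
  unfold fockSign
  rw [Finset.filter_insert]
  split_ifs with h
  · rw [Finset.card_insert_of_notMem (by simp [hj]), pow_succ]; ring
  · simp

lemma fockSign_erase {i j : ι} {S : Finset ι} (hj : j ∈ S) :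
    fockSign i (S.erase j) = (if j < i then -1 else 1) * fockSign i S := by
  have h := fockSign_insert (i := i) (Finset.notMem_erase j S)
  rw [Finset.insert_erase hj] at h
  rw [h, ← mul_assoc]
  split_ifs <;> simp

lemma adjoint_modeCreation_slater (i : ι) (S : Finset ι) :
    ContinuousLinearMap.adjoint (modeCreation i) (slater S) =
      if i ∈ S then fockSign i S • slater (S.erase i) else 0 := by
  refine InnerProductSpace.ext_inner_left_basis slater.toBasis fun T => ?_
  rw [OrthonormalBasis.coe_toBasis, ContinuousLinearMap.adjoint_inner_right, modeCreation_slater]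
  have hs : ∀ i (U : Finset ι), starRingEnd ℂ (fockSign i U) = fockSign i U := by
    intro i U; simp [fockSign]
  by_cases hT : i ∈ T <;> by_cases hS : i ∈ S <;>
    simp only [hT, hS, if_true, if_false, inner_zero_left, inner_zero_right, inner_smul_left,
      inner_smul_right, slater.inner_eq_ite, hs]
  · rw [if_neg, mul_zero]
    rintro rfl; simp at hT
  · by_cases h : insert i T = S
    · subst h
      rw [if_pos rfl, Finset.erase_insert hT, if_pos rfl, fockSign_insert_self]
    · rw [if_neg h, if_neg]
      · simp
      · rintro rfl
        exact h (Finset.insert_erase hS)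
  · rw [if_neg, mul_zero]
    rintro rfl; simp at hS

lemma modeCreation_anticomm (i j : ι) :
    modeCreation i * modeCreation j + modeCreation j * modeCreation i =
      (0 : Fock ι →L[ℂ] Fock ι) := by
  refine ContinuousLinearMap.coe_injective (slater.toBasis.ext fun S => ?_)
  rw [OrthonormalBasis.coe_toBasis]
  change modeCreation i (modeCreation j (slater S)) + modeCreation j (modeCreation i (slater S)) = 0
  rw [modeCreation_slater, modeCreation_slater]
  rcases eq_or_ne i j with rfl | hij
  · by_cases hi : i ∈ S <;> simp [hi, modeCreation_slater]
  by_cases hi : i ∈ S <;> by_cases hj : j ∈ S <;>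
    simp [hi, hj, hij, hij.symm, modeCreation_slater, smul_smul]
  rw [fockSign_insert hi, fockSign_insert hj, Finset.insert_comm, ← add_smul]
  rcases lt_or_gt_of_ne hij with h | h
  · simp [h, h.not_gt, mul_comm]
  · simp [h, h.not_gt, mul_comm]

lemma mode_anticomm (i j : ι) :
    ContinuousLinearMap.adjoint (modeCreation i) * modeCreation j +
      modeCreation j * ContinuousLinearMap.adjoint (modeCreation i) =
      if i = j then (1 : Fock ι →L[ℂ] Fock ι) else 0 := by
  refine ContinuousLinearMap.coe_injective (slater.toBasis.ext fun S => ?_)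
  rw [OrthonormalBasis.coe_toBasis]
  change ContinuousLinearMap.adjoint (modeCreation i) (modeCreation j (slater S)) +
    modeCreation j (ContinuousLinearMap.adjoint (modeCreation i) (slater S)) =
    (if i = j then (1 : Fock ι →L[ℂ] Fock ι) else 0) (slater S)
  rw [modeCreation_slater, adjoint_modeCreation_slater]
  rcases eq_or_ne i j with rfl | hij
  · by_cases hi : i ∈ S
    · simp [hi, modeCreation_slater, fockSign_erase_self, smul_smul, fockSign_mul_self]
    · simp [hi, adjoint_modeCreation_slater, fockSign_insert_self, smul_smul, fockSign_mul_self]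
  by_cases hi : i ∈ S <;> by_cases hj : j ∈ S <;>
    simp [hi, hj, hij, hij.symm, modeCreation_slater, adjoint_modeCreation_slater, smul_smul]
  rw [fockSign_insert hj, fockSign_erase hi, Finset.erase_insert_of_ne hij.symm, ← add_smul]
  rcases lt_or_gt_of_ne hij with h | h
  · simp [h, h.not_gt, mul_comm]
  · simp [h, h.not_gt, mul_comm]

lemma annihilation_eq (φ : EuclideanSpace ℂ ι) :
    annihilation φ = ∑ i, star (φ i) • ContinuousLinearMap.adjoint (modeCreation i) := by
  simp only [annihilation, creation, LinearMap.coe_mk, AddHom.coe_mk, map_sum]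
  exact Finset.sum_congr rfl fun i _ => map_smulₛₗ _ _ _

lemma creation_anticomm (φ ψ : EuclideanSpace ℂ ι) :
    creation φ * creation ψ = - (creation ψ * creation φ) := by
  rw [eq_neg_iff_add_eq_zero]
  simp only [creation, LinearMap.coe_mk, AddHom.coe_mk, Finset.sum_mul_sum, smul_mul_smul_comm]
  rw [Finset.sum_comm (s := Finset.univ (α := ι))]
  simp only [← Finset.sum_add_distrib]
  refine Finset.sum_eq_zero fun i _ => Finset.sum_eq_zero fun j _ => ?_
  rw [mul_comm (φ j), ← smul_add, modeCreation_anticomm, smul_zero]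

lemma annihilation_mul_creation (φ ψ : EuclideanSpace ℂ ι) :
    annihilation φ * creation ψ = ⟪φ, ψ⟫_ℂ • 1 - creation ψ * annihilation φ := by
  rw [eq_sub_iff_add_eq, annihilation_eq]
  simp only [creation, LinearMap.coe_mk, AddHom.coe_mk, Finset.sum_mul_sum, smul_mul_smul_comm]
  rw [Finset.sum_comm (f := fun i j => (ψ i * _) • _)]
  simp only [← Finset.sum_add_distrib]
  have : ∀ i j, (star (φ i) * ψ j) • (ContinuousLinearMap.adjoint (modeCreation i) * modeCreation j) +
      (ψ j * star (φ i)) • (modeCreation j * ContinuousLinearMap.adjoint (modeCreation i)) =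
      if i = j then (ψ j * star (φ i)) • (1 : Fock ι →L[ℂ] Fock ι) else 0 := by
    intro i j
    rw [mul_comm, ← smul_add, mode_anticomm]
    split_ifs <;> simp
  simp only [this, Finset.sum_ite_eq, Finset.mem_univ, if_true]
  rw [← Finset.sum_smul, PiLp.inner_apply]
  simp [RCLike.inner_apply]


lemma isCAR_creation : IsCAR (creation (ι := ι)) :=
  ⟨creation_anticomm, annihilation_mul_creation⟩

/-- `ρ` is the density operator of the gauge-invariant quasi-free state `ω_Q`, i.e. of the state with
`ω_Q(a(φ₁)* ⋯ a(φₙ)* a(ψₘ) ⋯ a(ψ₁)) = δ_{nm} det (⟨ψᵢ, Q φⱼ⟩)`. -/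
structure IsQuasiFreeDensity (Q : EuclideanSpace ℂ ι →L[ℂ] EuclideanSpace ℂ ι)
    (ρ : Fock ι →L[ℂ] Fock ι) : Prop where
  nonneg : 0 ≤ ρ
  trace_eq_one : opTrace ρ = 1
  moment : ∀ (n : ℕ) (φ ψ : Fin n → EuclideanSpace ℂ ι),
    opTrace (ρ * (creationProd creation φ * annihilationProd creation ψ)) =
      (Matrix.of fun i j => ⟪ψ i, Q (φ j)⟫_ℂ).det
  moment_ne : ∀ (n m : ℕ), n ≠ m →
    ∀ (φ : Fin n → EuclideanSpace ℂ ι) (ψ : Fin m → EuclideanSpace ℂ ι),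
      opTrace (ρ * (creationProd creation φ * annihilationProd creation ψ)) = 0

theorem exists_isQuasiFreeDensity (Q : EuclideanSpace ℂ ι →L[ℂ] EuclideanSpace ℂ ι)
    (h0 : 0 ≤ Q) (h1 : Q ≤ 1) : ∃ ρ : Fock ι →L[ℂ] Fock ι, IsQuasiFreeDensity Q ρ := by
  have hpos := (ContinuousLinearMap.nonneg_iff_isPositive Q).mp h0
  have hpos1 : (1 - Q).IsPositive := h1
  have hsym : Q.toLinearMap.IsSymmetric := hpos.isSymmetric
  have hm : Module.finrank ℂ (EuclideanSpace ℂ ι) = Fintype.card ι := finrank_euclideanSpace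
  set b := hsym.eigenvectorBasis hm with hb
  set q := hsym.eigenvalues hm with hq
  have hQ : ∀ j, Q (b j) = (q j : ℂ) • b j := fun j => hsym.apply_eigenvectorBasis hm j
  have hin : ∀ j, ⟪b j, Q (b j)⟫_ℂ = q j := by
    intro j
    rw [hQ, inner_smul_right, inner_self_eq_norm_sq_to_K, b.norm_eq_one]
    simp
  have hq0 : ∀ j, 0 ≤ q j := by
    intro j
    have h := hpos.inner_nonneg_right (b j)
    rw [hin] at h
    exact Complex.zero_le_real.mp h
  have hq1 : ∀ j, q j ≤ 1 := by
    intro j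
    have h := hpos1.inner_nonneg_right (b j)
    have e : ⟪b j, (1 - Q) (b j)⟫_ℂ = ((1 - q j : ℝ) : ℂ) := by
      change ⟪b j, b j - Q (b j)⟫_ℂ = _
      rw [inner_sub_right, hin, inner_self_eq_norm_sq_to_K, b.norm_eq_one]
      simp
    rw [e] at h
    exact sub_nonneg.mp (Complex.zero_le_real.mp h)
  have hc := isCAR_creation (ι := ι)
  have htr : opTrace (factorProd (creation (ι := ι)) b q (List.finRange _)) = 1 := by
    rw [opTrace_factorProd b q hc (List.nodup_finRange _), List.length_finRange]
    have h2 : opTrace (1 : Fock ι →L[ℂ] Fock ι) = 2 ^ Fintype.card ι := by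
      have h3 : Module.finrank ℂ (Fock ι) = 2 ^ Fintype.card ι := by
        rw [Module.finrank_eq_card_basis (slater (ι := ι)).toBasis, Fintype.card_finset]
      have h4 := LinearMap.trace_one ℂ (Fock ι)
      rw [h3] at h4
      simpa [opTrace] using h4
    rw [h2]
    exact div_self (pow_ne_zero _ two_ne_zero)
  refine ⟨factorProd creation b q (List.finRange _), factorProd_nonneg b q hc hq0 hq1 _, htr, ?_,
    fun n m hnm φ ψ => wick_ne b q hc hnm φ ψ⟩
  intro n φ ψ
  rw [wick_det b q hc Q hQ, htr, one_mul]

/-- The density operator of the quasi-free state with symbol `Q`, `0 ≤ Q ≤ I`. It is determined by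
`IsQuasiFreeDensity`, as the products of creation and annihilation operators in that definition
span all operators on the Fock space. -/
def quasiFreeDensity (Q : EuclideanSpace ℂ ι →L[ℂ] EuclideanSpace ℂ ι) (h0 : 0 ≤ Q)
    (h1 : Q ≤ 1) : Fock ι →L[ℂ] Fock ι :=
  (exists_isQuasiFreeDensity Q h0 h1).choose

/-- The number operator `N_E = ∑ₖ a(eₖ)* a(eₖ)`, with `(eₖ)` an orthonormal basis of `ran E`;
it does not depend on the choice of the basis. -/
def numberOp (E : EuclideanSpace ℂ ι →L[ℂ] EuclideanSpace ℂ ι) : Fock ι →L[ℂ] Fock ι :=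
  ∑ k, creation (stdOrthonormalBasis ℂ (LinearMap.range E.toLinearMap) k : EuclideanSpace ℂ ι) *
    annihilation (stdOrthonormalBasis ℂ (LinearMap.range E.toLinearMap) k : EuclideanSpace ℂ ι)

/-- The spectral projection of `N_E` for the eigenvalues `0, …, ⌊Tr E / 2⌋`. -/
def numberTest (E : EuclideanSpace ℂ ι →L[ℂ] EuclideanSpace ℂ ι) : Fock ι →L[ℂ] Fock ι :=
  (⨆ k ∈ Finset.range (⌊(opTrace E).re / 2⌋₊ + 1),
    Module.End.eigenspace (numberOp E).toLinearMap (k : ℂ)).starProjection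

end FermionicFockSpace

instance : Fact (0 < 2 * Real.pi) := ⟨Real.two_pi_pos⟩

/-- The torus `ℝ / 2πℤ`. -/
abbrev Torus : Type := AddCircle (2 * Real.pi)

/-- `ℓ²_d(ℤ) = ⨁_{a < d} ℓ²(ℤ)`. -/
abbrev ChainSpace (d : ℕ) : Type := PiLp 2 fun _ : Fin d => lp (fun _ : ℤ => ℂ) 2

/-- `L²_d(𝕋) = ⨁_{a < d} L²(𝕋)`, for the Haar probability measure on the torus. -/
abbrev TorusSpace (d : ℕ) : Type :=
  PiLp 2 fun _ : Fin d => Lp ℂ 2 (haarAddCircle (T := 2 * Real.pi))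

/-- `ℬ(ℂ^d)`, with the operator norm and the Löwner order. -/
abbrev SiteMatrix (d : ℕ) : Type := EuclideanSpace ℂ (Fin d) →L[ℂ] EuclideanSpace ℂ (Fin d)

/-- The Fourier transform `ℓ²_d(ℤ) → L²_d(𝕋)`, `1_{k} ⊗ e_a ↦ e^{ikx} ⊗ e_a`. -/
def chainFourier (d : ℕ) : ChainSpace d ≃ₗᵢ[ℂ] TorusSpace d :=
  LinearIsometryEquiv.piLpCongrRight 2 fun _ => fourierBasis.repr.symm

/-- `q ∈ L^∞(𝕋, ℬ(ℂ^d))` is the symbol function of the operator `Q` on `ℓ²_d(ℤ)`, which means that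
`Q = ℱ⁻¹ M_q ℱ`. In particular `Q` is translation-invariant. -/
structure IsSymbol {d : ℕ} (q : Torus → SiteMatrix d) (Q : ChainSpace d →L[ℂ] ChainSpace d) :
    Prop where
  memLp : MemLp q ⊤ haarAddCircle
  fourier_apply : ∀ f : ChainSpace d, ∀ᵐ x ∂haarAddCircle,
    WithLp.toLp 2 (fun a => chainFourier d (Q f) a x) =
      q x (WithLp.toLp 2 fun a => chainFourier d f a x)

/-- `ℓ²_d([n]^*) = ℓ²({0, …, n - 1}) ⊗ ℂ^d`. The order of the index set only fixes signs in the basis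
of the Fock space. -/
abbrev LocalSpace (n d : ℕ) : Type := EuclideanSpace ℂ (Fin n ×ₗ Fin d)

/-- The inclusion of `ℓ²_d([n]^*)` in `ℓ²_d(ℤ)`. -/
def localInclusion (n d : ℕ) : LocalSpace n d →L[ℂ] ChainSpace d :=
  LinearMap.toContinuousLinearMap
    { toFun := fun x => WithLp.toLp 2 fun a =>
        ∑ k : Fin n, lp.single 2 ((k : ℕ) : ℤ) (x (toLex (k, a)))
      map_add' := fun x y => by
        ext a : 1
        simp [Finset.sum_add_distrib]
      map_smul' := fun z x => by
        ext a : 1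
        simp [Finset.smul_sum, ← lp.single_smul] }

lemma inner_localInclusion (n d : ℕ) (x y : LocalSpace n d) :
    ⟪localInclusion n d x, localInclusion n d y⟫_ℂ = ⟪x, y⟫_ℂ := by
  have hsum : ∀ F : Fin n ×ₗ Fin d → ℂ, ∑ i, F i = ∑ a, ∑ k, F (toLex (k, a)) := by
    intro F
    rw [← Equiv.sum_comp (toLex : Fin n × Fin d ≃ Fin n ×ₗ Fin d) F, Fintype.sum_prod_type,
      Finset.sum_comm]
  rw [PiLp.inner_apply, PiLp.inner_apply, hsum]
  refine Finset.sum_congr rfl fun a _ => ?_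
  have h : ∀ z : LocalSpace n d, localInclusion n d z a =
      ∑ k : Fin n, lp.single 2 ((k : ℕ) : ℤ) (z (toLex (k, a))) := fun z => rfl
  rw [h x, h y, sum_inner]
  refine Finset.sum_congr rfl fun k _ => ?_
  rw [lp.inner_single_left]
  congr 1
  rw [lp.coeFn_sum, Finset.sum_apply]
  rw [Finset.sum_eq_single k]
  · simp
  · intro j _ hjk
    rw [lp.single_apply_ne]
    intro h
    apply hjk
    apply Fin.ext
    exact_mod_cast h.symm
  · simp

/-- The compression `Q_n` of `Q` to `ℓ²_d([n]^*)`. -/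
def cutoff {d : ℕ} (Q : ChainSpace d →L[ℂ] ChainSpace d) (n : ℕ) :
    LocalSpace n d →L[ℂ] LocalSpace n d :=
  ContinuousLinearMap.adjoint (localInclusion n d) ∘L Q ∘L localInclusion n d

lemma cutoff_nonneg {d : ℕ} {Q : ChainSpace d →L[ℂ] ChainSpace d} (h : 0 ≤ Q) (n : ℕ) :
    0 ≤ cutoff Q n := by
  rw [ContinuousLinearMap.nonneg_iff_isPositive] at h ⊢
  exact h.adjoint_conj _

lemma cutoff_le_one {d : ℕ} {Q : ChainSpace d →L[ℂ] ChainSpace d} (h : Q ≤ 1) (n : ℕ) :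
    cutoff Q n ≤ 1 := by
  have h1 : (1 - Q).IsPositive := h
  have h2 := h1.adjoint_conj (localInclusion n d)
  have h3 : ContinuousLinearMap.adjoint (localInclusion n d) ∘L (1 - Q) ∘L localInclusion n d =
      1 - cutoff Q n := by
    ext1 x
    refine ext_inner_left ℂ fun y => ?_
    change ⟪y, ContinuousLinearMap.adjoint (localInclusion n d)
      (localInclusion n d x - Q (localInclusion n d x))⟫_ℂ =
      ⟪y, x - ContinuousLinearMap.adjoint (localInclusion n d) (Q (localInclusion n d x))⟫_ℂ
    rw [map_sub, inner_sub_right, inner_sub_right, ContinuousLinearMap.adjoint_inner_right,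
      inner_localInclusion]
  rw [h3] at h2
  exact h2

/-- The density operator of the restriction to the sites `0, …, n - 1` of the quasi-free state with
symbol `Q`. -/
def localDensity {d : ℕ} (Q : ChainSpace d →L[ℂ] ChainSpace d) (h0 : 0 ≤ Q) (h1 : Q ≤ 1) (n : ℕ) :
    Fock (Fin n ×ₗ Fin d) →L[ℂ] Fock (Fin n ×ₗ Fin d) :=
  quasiFreeDensity (cutoff Q n) (cutoff_nonneg h0 n) (cutoff_le_one h1 n)

/-- The operator `A ⊗ B` on `ℓ²({0, …, n - 1}) ⊗ ℂ^d`. -/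
def tensorOp {n d : ℕ} (A : Matrix (Fin n) (Fin n) ℂ) (B : Matrix (Fin d) (Fin d) ℂ) :
    LocalSpace n d →L[ℂ] LocalSpace n d :=
  Matrix.toEuclideanCLM (𝕜 := ℂ) ((A ⊗ₖ B).reindex toLex toLex)

/-- The discrete Fourier transform `F_n 1_{k} = n^{-1/2} ∑ⱼ e^{2πijk/n} 1_{j}`. -/
def dftMatrix (n : ℕ) : Matrix (Fin n) (Fin n) ℂ :=
  Matrix.of fun j k =>
    (1 / Real.sqrt n : ℝ) * Complex.exp (Complex.I * (2 * Real.pi / n) * j * k)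

/-- `θ_k = 2πk/n`. -/
def dftAngle (n : ℕ) (k : Fin n) : ℝ := 2 * Real.pi * k / n

/-- `{A > 0}`: the sum of the spectral projections of a self-adjoint `A` for its positive
eigenvalues. -/
def posProjection {d : ℕ} (A : SiteMatrix d) : SiteMatrix d :=
  (⨆ a : Set.Ioi (0 : ℝ),
    Module.End.eigenspace A.toLinearMap ((a : ℝ) : ℂ)).starProjection

open Classical in
/-- `(F_n ⊗ I)^* (∑_{k : θ_k ∈ [μ+δ, ν-δ]} |1_k⟩⟨1_k| ⊗ {r(θ_k) - q(θ_k) > 0}) (F_n ⊗ I)`. -/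
def fourierWindow {d : ℕ} (q r : Torus → SiteMatrix d) (μ ν δ : ℝ) (n : ℕ) :
    LocalSpace n d →L[ℂ] LocalSpace n d :=
  ContinuousLinearMap.adjoint (tensorOp (dftMatrix n) (1 : Matrix (Fin d) (Fin d) ℂ)) ∘L
    (∑ k with dftAngle n k ∈ Set.Icc (μ + δ) (ν - δ),
      tensorOp (Matrix.single k k 1) ((Matrix.toEuclideanCLM (n := Fin d) (𝕜 := ℂ)).symm
        (posProjection (r (dftAngle n k : Torus) - q (dftAngle n k : Torus))))) ∘L
    tensorOp (dftMatrix n) (1 : Matrix (Fin d) (Fin d) ℂ)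

/-- `Tr ρ (I - T)`, which is real for self-adjoint `ρ` and `T`. -/
def errZero {E : Type*} [NormedAddCommGroup E] [InnerProductSpace ℂ E] (ρ T : E →L[ℂ] E) : ℝ :=
  (opTrace (ρ * (1 - T))).re

/-- `Tr ρ T`, which is real for self-adjoint `ρ` and `T`. -/
def errOne {E : Type*} [NormedAddCommGroup E] [InnerProductSpace ℂ E] (ρ T : E →L[ℂ] E) : ℝ :=
  (opTrace (ρ * T)).re

/-- Some tests `0 ≤ T_n ≤ I` satisfy `-(1/n) log Tr ρ_n (I - T_n) → +∞` and
`-(1/n) log Tr σ_n T_n → +∞`, in the extended reals, with `log 0 = -∞`. -/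
def SuperExpDiscriminated {d : ℕ}
    (ρ σ : (n : ℕ) → Fock (Fin n ×ₗ Fin d) →L[ℂ] Fock (Fin n ×ₗ Fin d)) : Prop :=
  ∃ T : (n : ℕ) → Fock (Fin n ×ₗ Fin d) →L[ℂ] Fock (Fin n ×ₗ Fin d),
    (∀ n, 0 ≤ T n ∧ T n ≤ 1) ∧
    Tendsto (fun n : ℕ => (((1 / n : ℝ)) : EReal) *
      -ENNReal.log (ENNReal.ofReal (errZero (ρ n) (T n)))) atTop (𝓝 ⊤) ∧
    Tendsto (fun n : ℕ => (((1 / n : ℝ)) : EReal) *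
      -ENNReal.log (ENNReal.ofReal (errOne (σ n) (T n)))) atTop (𝓝 ⊤)

end

/-!
Both cases of the hypothesis amount to the same picture (`exists_error_bound`): over `[μ, ν]` there
is a Lipschitz family of non-zero projections `p x` (`p = r` in the first case, `p = 1 - q` in the
second) such that `q x` vanishes and `r x` is the identity on the range of `p x`, and `p x` is the
spectral projection `{r x - q x > 0}` (`posProjection_sub`). Hence the range of the Fourier window
is spanned by plane waves which are almost empty in the state of `Q` and almost filled in the
state of `R`.

Quantitatively, the expectation of `Q_n` in a plane wave of momentum `θ` and polarization `v` is the
integral of `⟨v, q x v⟩` against the Fejér kernel `|g|²` centred at `θ`. For `x ∈ [μ, ν]`, as `q x` is a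
positive contraction which vanishes on the range of `p x`, one has `⟨v, q x v⟩ ≤ ‖v - p x v‖²`,
which is quadratically small at `θ` when `p θ v = v` (`exists_quadratic_bound`), and
`|g x|² |1 - e^{i(x - θ)}|² ≤ 4 / n` pointwise. So each expectation is `O(1 / n)`
(`IsSymbol.inner_cutoff_planeWave_le`), and the expected total number of particles in the window
stays bounded as `n → ∞`, although the dimension of the window grows linearly. The same holds for
the number of holes in the state of `R`, with `1 - r` in place of `q`.

In a quasi-free state the number of particles in a subspace is distributed as a sum of independent
Bernoulli variables, whose parameters are the eigenvalues of the compressed symbol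
(`exists_bernoulli_number`): the joint spectral projections of the commuting mode numbers of an
eigenbasis have expectations given by the determinant formula, which is diagonal. A Chernoff bound
(`sum_bernoulli_le`) with parameter `z` bounds the error probabilities by
`z ^ (-m / 2) * exp ((z - 1) * s)`, with `m` the dimension of the window and `s` the bounded
expected number of particles or holes. The choice `z = n` gives `e^{-c n log n}`.
-/

/-! ### Joint spectral projections of the occupation numbers -/

section Occupation

variable {H E : Type*} [NormedAddCommGroup H] [InnerProductSpace ℂ H]
  [NormedAddCommGroup E] [InnerProductSpace ℂ E] [CompleteSpace E]
  {c : H →ₗ[ℂ] (E →L[ℂ] E)} {m : ℕ} (b : OrthonormalBasis (Fin m) ℂ H)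

lemma modeNumber_mul_self (hc : IsCAR c) (j : Fin m) :
    modeNumber c b j * modeNumber c b j = modeNumber c b j := by
  have h : modeNumber c b j * c (b j) = c (b j) := by
    rw [modeNumber_mul b hc, modeNumber, ← mul_assoc, c_sq hc, zero_mul, add_zero]
    simp
  nth_rewrite 2 [modeNumber]
  rw [← mul_assoc, h, modeNumber]

lemma modeNumber_mul_factorProd (hc : IsCAR c) {q : Fin m → ℝ} {j : Fin m}
    (hq : q j = 0 ∨ q j = 1) {l : List (Fin m)} (hj : j ∈ l) :
    modeNumber c b j * factorProd c b q l = (q j : ℂ) • factorProd c b q l := by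
  induction l with
  | nil => simp at hj
  | cons i l ih =>
    rw [factorProd_cons]
    rcases eq_or_ne i j with rfl | hij
    · rw [← mul_assoc, ← smul_mul_assoc]
      congr 1
      rcases hq with hq | hq <;>
        simp [modeFactor, hq, mul_sub, modeNumber_mul_self b hc]
    · have hj' : j ∈ l := by
        rcases List.mem_cons.mp hj with h | h
        · exact absurd h.symm hij
        · exact h
      rw [← mul_assoc, ← (commute_modeFactor b q (commute_modeNumber_modeNumber b hc i j)).eq,
        mul_assoc, ih hj', mul_smul_comm]

lemma factorProd_congr {q q' : Fin m → ℝ} {l : List (Fin m)} (h : ∀ j ∈ l, q j = q' j) :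
    factorProd c b q l = factorProd c b q' l := by
  unfold factorProd
  congr 1
  refine List.map_congr_left fun j hj => ?_
  simp [modeFactor, h j hj]

/-- The indicator function of `S`, as a weight on the modes. -/
noncomputable def occWeight (S : Finset (Fin m)) (j : Fin m) : ℝ := if j ∈ S then 1 else 0

lemma occWeight_eq (S : Finset (Fin m)) (j : Fin m) : occWeight S j = 0 ∨ occWeight S j = 1 := by
  unfold occWeight; split_ifs <;> simp

/-- The projection onto the joint eigenspace of the mode numbers in which exactly the modes in `S`
are occupied. -/
noncomputable def occProj (c : H →ₗ[ℂ] (E →L[ℂ] E)) (b : OrthonormalBasis (Fin m) ℂ H)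
    (S : Finset (Fin m)) : E →L[ℂ] E := factorProd c b (occWeight S) (List.finRange m)

lemma sum_factorProd_occWeight {l : List (Fin m)} (hl : l.Nodup) :
    ∑ S ∈ l.toFinset.powerset, factorProd c b (occWeight S) l = 1 := by
  induction l with
  | nil => simp [factorProd]
  | cons j l ih =>
    obtain ⟨hj, hl⟩ := List.nodup_cons.mp hl
    have hj' : j ∉ l.toFinset := by simpa using hj
    rw [List.toFinset_cons, Finset.sum_powerset_insert hj', ← Finset.sum_add_distrib]
    rw [← ih hl]
    refine Finset.sum_congr rfl fun S hS => ?_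
    have hjS : j ∉ S := fun h => hj' (Finset.mem_powerset.mp hS h)
    have h1 : factorProd c b (occWeight (insert j S)) l = factorProd c b (occWeight S) l := by
      refine factorProd_congr b fun i hi => ?_
      have : i ≠ j := by rintro rfl; exact hj hi
      simp [occWeight, this]
    rw [factorProd_cons, factorProd_cons, h1, ← add_mul]
    simp [modeFactor, occWeight, hjS]

lemma sum_occProj : ∑ S, occProj c b S = 1 := by
  have h := sum_factorProd_occWeight (c := c) b (List.nodup_finRange m)
  rw [List.toFinset_finRange, Finset.powerset_univ] at h
  exact h

lemma sum_modeNumber_mul_occProj (hc : IsCAR c) (S : Finset (Fin m)) :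
    (∑ j, modeNumber c b j) * occProj c b S = (S.card : ℂ) • occProj c b S := by
  rw [Finset.sum_mul, occProj]
  simp only [fun j => modeNumber_mul_factorProd b hc (occWeight_eq S j) (List.mem_finRange j)]
  rw [← Finset.sum_smul]
  congr 1
  simp [occWeight, apply_ite ((↑) : ℝ → ℂ)]

/-- Normal ordering: for distinct modes, `c₁ ⋯ cₖ aₖ ⋯ a₁ = n₁ ⋯ nₖ`. -/
lemma prod_map_creation_mul_annihilation (hc : IsCAR c) {l : List (Fin m)} (hl : l.Nodup) :
    (l.map fun j => c (b j)).prod *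
        (l.map fun j => ContinuousLinearMap.adjoint (c (b j))).reverse.prod =
      (l.map (modeNumber c b)).prod := by
  induction l with
  | nil => simp
  | cons j l ih =>
    obtain ⟨hj, hl⟩ := List.nodup_cons.mp hl
    have hcomm : Commute (l.map (modeNumber c b)).prod (ContinuousLinearMap.adjoint (c (b j))) := by
      refine Commute.list_prod_left _ _ fun y hy => ?_
      obtain ⟨i, hi, rfl⟩ := List.mem_map.mp hy
      exact commute_modeNumber' b hc (by rintro rfl; exact hj hi)
    simp only [List.map_cons, List.prod_cons, List.reverse_cons, List.prod_append, List.prod_nil,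
      mul_one]
    rw [mul_assoc, ← mul_assoc (l.map fun j => c (b j)).prod, ih hl, hcomm.eq, ← mul_assoc,
      modeNumber]

variable {lam : Fin m → ℝ} {ρ : E →L[ℂ] E}

lemma opTrace_prod_modeNumber (hc : IsCAR c)
    (hρ : ∀ (k : ℕ) (f : Fin k → Fin m), Function.Injective f →
      opTrace (ρ * (creationProd c (fun i => b (f i)) * annihilationProd c (fun i => b (f i)))) =
        ∏ i, (lam (f i) : ℂ)) {l : List (Fin m)} (hl : l.Nodup) :
    opTrace (ρ * (l.map (modeNumber c b)).prod) = (l.map fun j => (lam j : ℂ)).prod := by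
  have h := hρ l.length l.get (List.nodup_iff_injective_get.mp hl)
  rw [← List.prod_ofFn] at h
  simp only [List.get_eq_getElem] at h
  rw [creationProd, annihilationProd, List.ofFn_getElem_eq_map l fun j => c (b j),
    List.ofFn_getElem_eq_map l fun j => ContinuousLinearMap.adjoint (c (b j)),
    List.ofFn_getElem_eq_map l fun j => (lam j : ℂ),
    prod_map_creation_mul_annihilation b hc hl] at h
  exact h

/-- Expanding the factors of the modes in `l'` one at a time reduces their expectation to
expectations of products of mode numbers. -/
lemma opTrace_prod_modeNumber_mul_factorProd (hc : IsCAR c)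
    (hρ : ∀ (k : ℕ) (f : Fin k → Fin m), Function.Injective f →
      opTrace (ρ * (creationProd c (fun i => b (f i)) * annihilationProd c (fun i => b (f i)))) =
        ∏ i, (lam (f i) : ℂ)) (q : Fin m → ℝ) (l l' : List (Fin m)) (hl : (l' ++ l).Nodup) :
    opTrace (ρ * ((l.map (modeNumber c b)).prod * factorProd c b q l')) =
      (l.map fun j => (lam j : ℂ)).prod *
        (l'.map fun j => (q j * lam j + (1 - q j) * (1 - lam j) : ℂ)).prod := by
  induction l' generalizing l with
  | nil =>
    simp only [factorProd, List.map_nil, List.prod_nil, mul_one]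
    exact opTrace_prod_modeNumber b hc hρ hl
  | cons j l' ih =>
    have hcomm : Commute (l.map (modeNumber c b)).prod (modeNumber c b j) := by
      refine Commute.list_prod_left _ _ fun y hy => ?_
      obtain ⟨i, hi, rfl⟩ := List.mem_map.mp hy
      exact commute_modeNumber_modeNumber b hc i j
    have hn : (l' ++ l).Nodup := (List.nodup_cons.mp hl).2
    have hn' : (l' ++ j :: l).Nodup := by
      rw [List.nodup_middle]; exact hl
    have h1 := ih l hn
    have h2 := ih (j :: l) hn'
    simp only [List.map_cons, List.prod_cons] at h2 ⊢
    have e : (l.map (modeNumber c b)).prod * factorProd c b q (j :: l') =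
        (2 * q j - 1 : ℂ) • (modeNumber c b j * (l.map (modeNumber c b)).prod *
          factorProd c b q l') +
        (1 - q j : ℂ) • ((l.map (modeNumber c b)).prod * factorProd c b q l') := by
      have hm : modeFactor c b q j = (2 * q j - 1 : ℂ) • modeNumber c b j + (1 - q j : ℂ) • 1 := by
        rw [modeFactor]; module
      rw [factorProd_cons, hm, ← hcomm.eq]
      simp only [add_mul, mul_add, smul_mul_assoc, mul_smul_comm, one_mul, mul_assoc]
    rw [e, mul_add, mul_smul_comm, mul_smul_comm, opTrace_add, opTrace_smul, opTrace_smul, h1, h2]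
    ring

/-- The occupation numbers are independent Bernoulli variables with parameters `lam i`. -/
lemma opTrace_occProj (hc : IsCAR c)
    (hρ : ∀ (k : ℕ) (f : Fin k → Fin m), Function.Injective f →
      opTrace (ρ * (creationProd c (fun i => b (f i)) * annihilationProd c (fun i => b (f i)))) =
        ∏ i, (lam (f i) : ℂ)) (S : Finset (Fin m)) :
    opTrace (ρ * occProj c b S) = ((∏ i ∈ S, lam i) * ∏ i ∈ Sᶜ, (1 - lam i) : ℝ) := by
  have h := opTrace_prod_modeNumber_mul_factorProd b hc hρ (occWeight S) [] (List.finRange m)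
    (by simpa using List.nodup_finRange m)
  simp only [List.map_nil, List.prod_nil, one_mul] at h
  rw [occProj, h, ← List.ofFn_eq_map, List.prod_ofFn, ← Finset.prod_mul_prod_compl S]
  push_cast
  congr 1
  · refine Finset.prod_congr rfl fun i hi => ?_
    simp [occWeight, hi]
  · refine Finset.prod_congr rfl fun i hi => ?_
    simp [occWeight, Finset.mem_compl.mp hi]

/-- The spectral projection of the number operator for the eigenvalues `0, …, K` is the sum of the
joint spectral projections with at most `K` occupied modes. -/
lemma starProjection_iSup_eigenspace [FiniteDimensional ℂ E] (hc : IsCAR c) (K : ℕ) :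
    (⨆ k ∈ Finset.range (K + 1), Module.End.eigenspace
      (∑ j, modeNumber c b j : E →L[ℂ] E).toLinearMap (k : ℂ)).starProjection =
      ∑ S : Finset (Fin m) with S.card ≤ K, occProj c b S := by
  set N : E →L[ℂ] E := ∑ j, modeNumber c b j with hN
  set U := ⨆ k ∈ Finset.range (K + 1), Module.End.eigenspace N.toLinearMap (k : ℂ)
  have hsym : N.toLinearMap.IsSymmetric := by
    have : IsSelfAdjoint N := by
      rw [IsSelfAdjoint, hN, star_sum]
      exact Finset.sum_congr rfl fun j _ => adjoint_modeNumber b j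
    exact ContinuousLinearMap.isSelfAdjoint_iff_isSymmetric.mp this
  have hmem : ∀ S x, occProj c b S x ∈ Module.End.eigenspace N.toLinearMap (S.card : ℂ) := by
    intro S x
    rw [Module.End.mem_eigenspace_iff]
    exact congrArg (fun A : E →L[ℂ] E => A x) (sum_modeNumber_mul_occProj b hc S)
  ext x
  have hx : x = ∑ S, occProj c b S x := by
    conv_lhs => rw [← one_apply_eq_self (F := E →L[ℂ] E) x, ← sum_occProj (c := c) b]
    rw [sum_apply]
  conv_lhs => rw [hx]
  rw [map_sum, sum_apply, Finset.sum_filter]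
  refine Finset.sum_congr rfl fun S _ => ?_
  split_ifs with hS
  · rw [Submodule.starProjection_eq_self_iff]
    refine (le_iSup₂_of_le (f := fun (k : ℕ) (_ : k ∈ Finset.range (K + 1)) =>
      Module.End.eigenspace N.toLinearMap (k : ℂ)) S.card ?_ le_rfl) (hmem S x)
    simpa [Nat.lt_succ_iff] using hS
  · rw [Submodule.starProjection_apply_eq_zero_iff]
    have hle : U ≤ (ℂ ∙ occProj c b S x)ᗮ := by
      refine iSup₂_le fun k hk y hy => ?_
      rw [Submodule.mem_orthogonal_singleton_iff_inner_right]
      have hne : (S.card : ℂ) ≠ (k : ℂ) := by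
        have := Finset.mem_range.mp hk
        intro h
        have : S.card = k := by exact_mod_cast h
        omega
      exact hsym.orthogonalFamily_eigenspaces.pairwise hne.symm hy _ (hmem S x)
    rw [Submodule.mem_orthogonal]
    intro u hu
    exact Submodule.mem_orthogonal_singleton_iff_inner_left.mp (hle hu)

end Occupation

/-! ### Chernoff bounds for sums of independent Bernoulli variables -/

section Chernoff

/-- The Chernoff bound for the number of successes in independent trials with success
probabilities `lam i`. -/
lemma sum_bernoulli_le {m : ℕ} {lam : Fin m → ℝ} (h0 : ∀ i, 0 ≤ lam i) (h1 : ∀ i, lam i ≤ 1)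
    {z : ℝ} (hz : 1 ≤ z) (k : ℕ) :
    ∑ S : Finset (Fin m) with k ≤ S.card, (∏ i ∈ S, lam i) * ∏ i ∈ Sᶜ, (1 - lam i) ≤
      (z ^ k)⁻¹ * Real.exp ((z - 1) * ∑ i, lam i) := by
  have hz0 : 0 < z := by linarith
  rw [← div_eq_inv_mul, le_div_iff₀ (pow_pos hz0 k)]
  have hw : ∀ S : Finset (Fin m), 0 ≤ (∏ i ∈ S, lam i) * ∏ i ∈ Sᶜ, (1 - lam i) := fun S =>
    mul_nonneg (Finset.prod_nonneg fun i _ => h0 i)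
      (Finset.prod_nonneg fun i _ => sub_nonneg.mpr (h1 i))
  calc (∑ S : Finset (Fin m) with k ≤ S.card, (∏ i ∈ S, lam i) * ∏ i ∈ Sᶜ, (1 - lam i)) * z ^ k
      = ∑ S : Finset (Fin m) with k ≤ S.card,
          ((∏ i ∈ S, lam i) * ∏ i ∈ Sᶜ, (1 - lam i)) * z ^ k := Finset.sum_mul _ _ _
    _ ≤ ∑ S : Finset (Fin m) with k ≤ S.card,
          ((∏ i ∈ S, lam i) * ∏ i ∈ Sᶜ, (1 - lam i)) * z ^ S.card := by
        refine Finset.sum_le_sum fun S hS => mul_le_mul_of_nonneg_left ?_ (hw S)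
        exact pow_le_pow_right₀ hz (Finset.mem_filter.mp hS).2
    _ ≤ ∑ S : Finset (Fin m), ((∏ i ∈ S, lam i) * ∏ i ∈ Sᶜ, (1 - lam i)) * z ^ S.card :=
        Finset.sum_le_sum_of_subset_of_nonneg (Finset.filter_subset _ _)
          fun S _ _ => mul_nonneg (hw S) (pow_nonneg hz0.le _)
    _ = ∏ i, (z * lam i + (1 - lam i)) := by
        rw [Fintype.prod_add]
        refine Finset.sum_congr rfl fun S _ => ?_
        rw [Finset.prod_mul_distrib, Finset.prod_const]
        ring
    _ ≤ ∏ i, Real.exp ((z - 1) * lam i) := by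
        refine Finset.prod_le_prod (fun i _ => ?_) fun i _ => ?_
        · nlinarith [h0 i, h1 i]
        · have := Real.add_one_le_exp ((z - 1) * lam i)
          linarith
    _ = Real.exp ((z - 1) * ∑ i, lam i) := by
        rw [← Real.exp_sum, Finset.mul_sum]

/-- The Chernoff bound for the number of failures. -/
lemma sum_bernoulli_compl_le {m : ℕ} {lam : Fin m → ℝ} (h0 : ∀ i, 0 ≤ lam i)
    (h1 : ∀ i, lam i ≤ 1) {z : ℝ} (hz : 1 ≤ z) (k : ℕ) :
    ∑ S : Finset (Fin m) with k ≤ Sᶜ.card, (∏ i ∈ S, lam i) * ∏ i ∈ Sᶜ, (1 - lam i) ≤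
      (z ^ k)⁻¹ * Real.exp ((z - 1) * ∑ i, (1 - lam i)) := by
  refine le_trans (le_of_eq ?_) (sum_bernoulli_le (lam := fun i => 1 - lam i)
    (fun i => sub_nonneg.mpr (h1 i)) (fun i => by linarith [h0 i]) hz k)
  rw [Finset.sum_filter, Finset.sum_filter, 
    ← Equiv.sum_comp (compl_involutive (α := Finset (Fin m))).toPerm]
  refine Finset.sum_congr rfl fun S _ => ?_
  simp [mul_comm]

end Chernoff

/-! ### Error probabilities of the number test in a quasi-free state -/

section NumberTest

variable {H E : Type*} [NormedAddCommGroup H] [InnerProductSpace ℂ H]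
  [NormedAddCommGroup E] [InnerProductSpace ℂ E] [CompleteSpace E]

/-- The number operator does not depend on the orthonormal basis. -/
lemma sum_creation_mul_adjoint_eq (c : H →ₗ[ℂ] (E →L[ℂ] E)) {κ κ' : Type*} [Fintype κ]
    [Fintype κ'] (b : OrthonormalBasis κ ℂ H) (b' : OrthonormalBasis κ' ℂ H) :
    ∑ k, c (b' k) * ContinuousLinearMap.adjoint (c (b' k)) =
      ∑ j, c (b j) * ContinuousLinearMap.adjoint (c (b j)) := by
  classical
  have h : ∀ k, c (b' k) * ContinuousLinearMap.adjoint (c (b' k)) =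
      ∑ j, ∑ l, (⟪b j, b' k⟫_ℂ * ⟪b' k, b l⟫_ℂ) •
        (c (b j) * ContinuousLinearMap.adjoint (c (b l))) := by
    intro k
    conv_lhs => rw [← b.sum_repr' (b' k)]
    simp only [map_sum, map_smul, map_smulₛₗ, Finset.sum_mul_sum, smul_mul_smul_comm,
      inner_conj_symm]
  simp only [h]
  rw [Finset.sum_comm]
  refine Finset.sum_congr rfl fun j _ => ?_
  rw [Finset.sum_comm]
  simp only [← Finset.sum_smul, b'.sum_inner_mul_inner, b.inner_eq_ite]
  simp

/-- The trace of the compression of `A` to the range of an orthogonal projection `P`, computed in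
an orthonormal basis of the range and in one of the whole space. -/
lemma sum_inner_range_eq [FiniteDimensional ℂ H] [CompleteSpace H] {P : H →L[ℂ] H}
    (hP : IsStarProjection P) (A : H →L[ℂ] H) {κ κ' : Type*} [Fintype κ] [Fintype κ']
    (b : OrthonormalBasis κ ℂ (LinearMap.range P.toLinearMap)) (e : OrthonormalBasis κ' ℂ H) :
    ∑ i, ⟪(b i : H), A (b i)⟫_ℂ = ∑ k, ⟪P (e k), A (P (e k))⟫_ℂ := by
  have hfix : ∀ x : LinearMap.range P.toLinearMap, P (x : H) = x := by
    rintro ⟨_, y, rfl⟩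
    exact congrArg (fun B : H →L[ℂ] H => B y) hP.isIdempotentElem
  have hadj : ∀ x y, ⟪P x, y⟫_ℂ = ⟪x, P y⟫_ℂ := by
    intro x y
    have h : star P = P := hP.isSelfAdjoint
    nth_rewrite 1 [← h]
    exact ContinuousLinearMap.adjoint_inner_left P y x
  -- cyclicity of the trace, for maps between the space and the range
  have h := LinearMap.trace_comp_comm' (R := ℂ) (P.toLinearMap.rangeRestrict)
    ((LinearMap.range P.toLinearMap).subtype ∘ₗ P.toLinearMap.rangeRestrict ∘ₗ A.toLinearMap ∘ₗ
      (LinearMap.range P.toLinearMap).subtype)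
  rw [LinearMap.trace_eq_sum_inner _ b, LinearMap.trace_eq_sum_inner _ e] at h
  have e1 : ∀ k, ⟪P (e k), A (P (e k))⟫_ℂ = ⟪e k, P (A (P (e k)))⟫_ℂ := fun k => hadj _ _
  have e2 : ∀ i, ⟪(b i : H), A (b i)⟫_ℂ = ⟪(b i : H), P (P (A (b i)))⟫_ℂ := by
    intro i
    rw [← hadj, ← hadj, hfix, hfix]
  simp only [e1, e2]
  exact h.symm

lemma opTrace_eq_finrank [FiniteDimensional ℂ H] [CompleteSpace H] {P : H →L[ℂ] H}
    (hP : IsStarProjection P) :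
    opTrace P = Module.finrank ℂ (LinearMap.range P.toLinearMap) := by
  refine LinearMap.IsProj.trace (p := LinearMap.range P.toLinearMap) ⟨fun x => ⟨x, rfl⟩, ?_⟩
  rintro _ ⟨y, rfl⟩
  exact congrArg (fun B : H →L[ℂ] H => B y) hP.isIdempotentElem

/-- A positive contraction compressed to a subspace is diagonal in some orthonormal basis. -/
lemma exists_eigenbasis_compression [FiniteDimensional ℂ H] [CompleteSpace H] {G : H →L[ℂ] H}
    (h0 : 0 ≤ G) (h1 : G ≤ 1) (V : Submodule ℂ H) {m : ℕ} (hm : Module.finrank ℂ V = m) :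
    ∃ (b : OrthonormalBasis (Fin m) ℂ V) (lam : Fin m → ℝ), (∀ i, 0 ≤ lam i) ∧
      (∀ i, lam i ≤ 1) ∧ ∀ i j, ⟪(b i : H), G (b j)⟫_ℂ = if i = j then (lam j : ℂ) else 0 := by
  have hpos := (ContinuousLinearMap.nonneg_iff_isPositive G).mp h0
  have hpos1 : (1 - G).IsPositive := h1
  set G' : V →L[ℂ] V := ContinuousLinearMap.adjoint V.subtypeL ∘L G ∘L V.subtypeL with hG'
  have hsym : G'.toLinearMap.IsSymmetric := (hpos.adjoint_conj V.subtypeL).isSymmetric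
  set b := hsym.eigenvectorBasis hm
  set lam := hsym.eigenvalues hm
  have hin : ∀ i j, ⟪(b i : H), G (b j)⟫_ℂ = if i = j then (lam j : ℂ) else 0 := by
    intro i j
    have h2 : ⟪(b i : H), G (b j)⟫_ℂ = ⟪b i, G' (b j)⟫_ℂ :=
      (ContinuousLinearMap.adjoint_inner_right V.subtypeL (b i) (G (b j))).symm
    have h3 : G' (b j) = (lam j : ℂ) • b j := hsym.apply_eigenvectorBasis hm j
    rw [h2, h3, inner_smul_right, b.inner_eq_ite]
    split_ifs <;> simp
  refine ⟨b, lam, fun i => ?_, fun i => ?_, hin⟩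
  · have h := hpos.inner_nonneg_right (b i : H)
    rw [hin, if_pos rfl] at h
    exact Complex.zero_le_real.mp h
  · have h := hpos1.inner_nonneg_right (b i : H)
    have e : ⟪(b i : H), (1 - G) (b i)⟫_ℂ = ((1 - lam i : ℝ) : ℂ) := by
      change ⟪(b i : H), b i - G (b i)⟫_ℂ = _
      rw [inner_sub_right, hin, if_pos rfl, ← Submodule.coe_inner, b.inner_eq_ite, if_pos rfl]
      simp
    rw [e] at h
    exact sub_nonneg.mp (Complex.zero_le_real.mp h)

/-- In a quasi-free state with symbol `G`, the number of particles in a subspace `V` is distributed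
as a sum of independent Bernoulli variables, whose parameters are the eigenvalues of the compression
of `G` to `V`. -/
lemma exists_bernoulli_number [FiniteDimensional ℂ H] [CompleteSpace H] [FiniteDimensional ℂ E]
    {c : H →ₗ[ℂ] (E →L[ℂ] E)} (hc : IsCAR c) {G : H →L[ℂ] H} (h0 : 0 ≤ G) (h1 : G ≤ 1)
    {ρ : E →L[ℂ] E}
    (hρ : ∀ (k : ℕ) (φ ψ : Fin k → H),
      opTrace (ρ * (creationProd c φ * annihilationProd c ψ)) =
        (Matrix.of fun i j => ⟪ψ i, G (φ j)⟫_ℂ).det)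
    (V : Submodule ℂ H) {m : ℕ} (hm : Module.finrank ℂ V = m) (K : ℕ) {T : E →L[ℂ] E}
    (hT : T = (⨆ k ∈ Finset.range (K + 1), Module.End.eigenspace
      (∑ k, c (stdOrthonormalBasis ℂ V k) *
        ContinuousLinearMap.adjoint (c (stdOrthonormalBasis ℂ V k))).toLinearMap
        (k : ℂ)).starProjection) :
    ∃ (b : OrthonormalBasis (Fin m) ℂ V) (lam : Fin m → ℝ),
      (∀ i, 0 ≤ lam i) ∧ (∀ i, lam i ≤ 1) ∧ (∀ i, ⟪(b i : H), G (b i)⟫_ℂ = lam i) ∧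
      errOne ρ T = ∑ S : Finset (Fin m) with S.card ≤ K,
        (∏ i ∈ S, lam i) * ∏ i ∈ Sᶜ, (1 - lam i) ∧
      errZero ρ T = ∑ S : Finset (Fin m) with ¬ S.card ≤ K,
        (∏ i ∈ S, lam i) * ∏ i ∈ Sᶜ, (1 - lam i) := by
  obtain ⟨b, lam, hl0, hl1, hin⟩ := exists_eigenbasis_compression h0 h1 V hm
  set c' : V →ₗ[ℂ] (E →L[ℂ] E) := c ∘ₗ V.subtype with hc'def
  have hc' : IsCAR c' := ⟨fun φ ψ => hc.1 _ _, fun φ ψ => hc.2 (φ : H) ψ⟩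
  have hmom : ∀ (k : ℕ) (f : Fin k → Fin m), Function.Injective f →
      opTrace (ρ * (creationProd c' (fun i => b (f i)) *
        annihilationProd c' (fun i => b (f i)))) = ∏ i, (lam (f i) : ℂ) := by
    intro k f hf
    have h := hρ k (fun i => (b (f i) : H)) fun i => b (f i)
    refine h.trans ?_
    have hdiag : (Matrix.of fun i j => ⟪(b (f i) : H), G (b (f j))⟫_ℂ) =
        Matrix.diagonal fun i => (lam (f i) : ℂ) := by
      ext i j
      rw [Matrix.of_apply, hin, Matrix.diagonal_apply]
      by_cases hij : i = j
      · simp [hij]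
      · rw [if_neg hij, if_neg fun h => hij (hf h)]
    rw [hdiag, Matrix.det_diagonal]
  have hocc := opTrace_occProj b hc' hmom
  have hT : T = ∑ S : Finset (Fin m) with S.card ≤ K, occProj c' b S := by
    rw [hT, ← starProjection_iSup_eigenspace b hc']
    have hN : (∑ k, c (stdOrthonormalBasis ℂ V k) *
        ContinuousLinearMap.adjoint (c (stdOrthonormalBasis ℂ V k))) = ∑ j, modeNumber c' b j :=
      sum_creation_mul_adjoint_eq c' b (stdOrthonormalBasis ℂ V)
    rw [hN]
  have hT' : 1 - T = ∑ S : Finset (Fin m) with ¬ S.card ≤ K, occProj c' b S := by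
    rw [hT, ← sum_occProj (c := c') b, ← Finset.sum_filter_add_sum_filter_not Finset.univ
      fun S : Finset (Fin m) => S.card ≤ K]
    abel
  refine ⟨b, lam, hl0, hl1, fun i => by rw [hin, if_pos rfl], ?_, ?_⟩
  · rw [errOne, hT, Finset.mul_sum, opTrace_sum, Complex.re_sum]
    exact Finset.sum_congr rfl fun S _ => by rw [hocc, Complex.ofReal_re]
  · rw [errZero, hT', Finset.mul_sum, opTrace_sum, Complex.re_sum]
    exact Finset.sum_congr rfl fun S _ => by rw [hocc, Complex.ofReal_re]

end NumberTest

section QuasiFree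

variable {ι : Type*} [Fintype ι] [LinearOrder ι]

/-- The error probabilities of the number test are exponentially small in the dimension of the
range, at any rate `log z / 2`, up to a factor controlled by the expected number of particles,
respectively of holes. -/
lemma numberTest_error_le {P G : EuclideanSpace ℂ ι →L[ℂ] EuclideanSpace ℂ ι}
    (hP : IsStarProjection P) (h0 : 0 ≤ G) (h1 : G ≤ 1) {ρ : Fock ι →L[ℂ] Fock ι}
    (hρ : IsQuasiFreeDensity G ρ) {m : ℕ}
    (hm : Module.finrank ℂ (LinearMap.range P.toLinearMap) = m) {κ : Type*} [Fintype κ]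
    (e : OrthonormalBasis κ ℂ (EuclideanSpace ℂ ι)) {z : ℝ} (hz : 1 ≤ z) :
    errZero ρ (numberTest P) ≤
        z ^ (-(m / 2 : ℝ)) * Real.exp ((z - 1) * ∑ k, (⟪P (e k), G (P (e k))⟫_ℂ).re) ∧
      errOne ρ (numberTest P) ≤
        z ^ (-(m / 2 : ℝ)) * Real.exp ((z - 1) * ∑ k, (⟪P (e k), (1 - G) (P (e k))⟫_ℂ).re) := by
  have hT : numberTest P = (⨆ k ∈ Finset.range (⌊(m / 2 : ℝ)⌋₊ + 1),
      Module.End.eigenspace (numberOp P).toLinearMap (k : ℂ)).starProjection := by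
    simp only [numberTest, opTrace_eq_finrank hP, hm, Complex.natCast_re]
  obtain ⟨b, lam, hl0, hl1, hin, hone, hzero⟩ :=
    exists_bernoulli_number isCAR_creation h0 h1 hρ.moment _ hm _ hT
  have hz0 : 0 < z := by linarith
  have hs0 : ∑ k, (⟪P (e k), G (P (e k))⟫_ℂ).re = ∑ i, lam i := by
    rw [← Complex.re_sum, ← sum_inner_range_eq hP G b e, Complex.re_sum]
    exact Finset.sum_congr rfl fun i _ => by rw [hin, Complex.ofReal_re]
  have hs1 : ∑ k, (⟪P (e k), (1 - G) (P (e k))⟫_ℂ).re = ∑ i, (1 - lam i) := by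
    rw [← Complex.re_sum, ← sum_inner_range_eq hP (1 - G) b e, Complex.re_sum]
    refine Finset.sum_congr rfl fun i _ => ?_
    change (⟪(b i : EuclideanSpace ℂ ι), b i - G (b i)⟫_ℂ).re = _
    rw [inner_sub_right, hin, ← Submodule.coe_inner, b.inner_eq_ite, if_pos rfl]
    simp
  have hpow : ∀ k : ℕ, (m / 2 : ℝ) ≤ k → (z ^ k)⁻¹ ≤ z ^ (-(m / 2 : ℝ)) := by
    intro k hk
    rw [← Real.rpow_natCast, ← Real.rpow_neg hz0.le]
    exact Real.rpow_le_rpow_of_exponent_le hz (neg_le_neg hk)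
  rw [hs0, hs1, hone, hzero]
  constructor
  · refine le_trans (le_of_eq ?_) ((sum_bernoulli_le hl0 hl1 hz (⌊(m / 2 : ℝ)⌋₊ + 1)).trans
      (mul_le_mul_of_nonneg_right (hpow _ ?_) (Real.exp_nonneg _)))
    · refine Finset.sum_congr (Finset.filter_congr fun S _ => ?_) fun _ _ => rfl
      omega
    · push_cast
      exact (Nat.lt_floor_add_one _).le
  · have hfl : (⌊(m / 2 : ℝ)⌋₊ : ℝ) ≤ m / 2 := Nat.floor_le (by positivity)
    have hfl' : ⌊(m / 2 : ℝ)⌋₊ ≤ m := by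
      have : (⌊(m / 2 : ℝ)⌋₊ : ℝ) ≤ m := hfl.trans (by linarith [Nat.cast_nonneg (α := ℝ) m])
      exact_mod_cast this
    refine le_trans (le_of_eq ?_) ((sum_bernoulli_compl_le hl0 hl1 hz (m - ⌊(m / 2 : ℝ)⌋₊)).trans
      (mul_le_mul_of_nonneg_right (hpow _ ?_) (Real.exp_nonneg _)))
    · refine Finset.sum_congr (Finset.filter_congr fun S _ => ?_) fun _ _ => rfl
      have := S.card_add_card_compl
      rw [Fintype.card_fin] at this
      omega
    · rw [Nat.cast_sub hfl']
      linarith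

end QuasiFree

/-! ### Plane waves and the Fourier window -/

section Window

variable {n d : ℕ}

/-- The vector `u ⊗ v` of `ℓ²({0, …, n - 1}) ⊗ ℂ^d`. -/
noncomputable def tensorVec (u : Fin n → ℂ) (v : EuclideanSpace ℂ (Fin d)) : LocalSpace n d :=
  WithLp.toLp 2 fun i => u (ofLex i).1 * v (ofLex i).2

lemma sum_lex {M : Type*} [AddCommMonoid M] (F : Fin n ×ₗ Fin d → M) :
    ∑ i, F i = ∑ k, ∑ a, F (toLex (k, a)) := by
  rw [← Equiv.sum_comp (toLex : Fin n × Fin d ≃ Fin n ×ₗ Fin d) F, Fintype.sum_prod_type]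

lemma tensorOp_tensorVec (A : Matrix (Fin n) (Fin n) ℂ) (B : Matrix (Fin d) (Fin d) ℂ)
    (u : Fin n → ℂ) (v : EuclideanSpace ℂ (Fin d)) :
    tensorOp A B (tensorVec u v) =
      tensorVec (A.mulVec u) (Matrix.toEuclideanCLM (n := Fin d) (𝕜 := ℂ) B v) := by
  ext i
  change ∑ j, (A ⊗ₖ B) (ofLex i) (ofLex j) * (u (ofLex j).1 * v (ofLex j).2) =
    (∑ j, A (ofLex i).1 j * u j) * ∑ a, B (ofLex i).2 a * v a
  rw [sum_lex, Finset.sum_mul_sum]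
  refine Finset.sum_congr rfl fun j _ => Finset.sum_congr rfl fun a _ => ?_
  rw [Matrix.kronecker_apply]
  simp only [ofLex_toLex]
  ring

lemma inner_tensorVec (u u' : Fin n → ℂ) (v v' : EuclideanSpace ℂ (Fin d)) :
    ⟪tensorVec u v, tensorVec u' v'⟫_ℂ = (∑ k, star (u k) * u' k) * ⟪v, v'⟫_ℂ := by
  rw [PiLp.inner_apply, PiLp.inner_apply, sum_lex, Finset.sum_mul_sum]
  refine Finset.sum_congr rfl fun j _ => Finset.sum_congr rfl fun a _ => ?_
  simp [tensorVec, RCLike.inner_apply]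
  ring

lemma tensorOp_mul (A A' : Matrix (Fin n) (Fin n) ℂ) (B B' : Matrix (Fin d) (Fin d) ℂ) :
    tensorOp A B * tensorOp A' B' = tensorOp (A * A') (B * B') := by
  rw [tensorOp, tensorOp, tensorOp, ← map_mul, Matrix.mul_kronecker_mul]
  simp only [Matrix.reindex_apply, Matrix.submatrix_mul_equiv]

lemma star_tensorOp (A : Matrix (Fin n) (Fin n) ℂ) (B : Matrix (Fin d) (Fin d) ℂ) :
    star (tensorOp A B) = tensorOp (star A) (star B) := by
  rw [tensorOp, tensorOp, ← map_star]
  congr 1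
  simp only [Matrix.star_eq_conjTranspose, Matrix.reindex_apply, Matrix.conjTranspose_submatrix,
    Matrix.conjTranspose_kronecker]

lemma tensorOp_one :
    tensorOp (1 : Matrix (Fin n) (Fin n) ℂ) (1 : Matrix (Fin d) (Fin d) ℂ) = 1 := by
  rw [tensorOp, Matrix.one_kronecker_one]
  simp

lemma dftMatrix_mul_star (hn : n ≠ 0) : dftMatrix n * star (dftMatrix n) = 1 := by
  have hn' : (n : ℂ) ≠ 0 := by exact_mod_cast hn
  set ζ := Complex.exp (2 * Real.pi * Complex.I / n) with hζ
  have hprim : IsPrimitiveRoot ζ n := Complex.isPrimitiveRoot_exp n hn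
  have hF : ∀ j k, dftMatrix n j k = (1 / Real.sqrt n : ℝ) * (ζ ^ (j : ℕ)) ^ (k : ℕ) := by
    intro j k
    rw [dftMatrix, Matrix.of_apply, hζ, ← pow_mul, ← Complex.exp_nat_mul]
    congr 2
    push_cast
    ring
  have hnorm : ‖ζ‖ = 1 := hprim.norm'_eq_one hn
  have hinv : star ζ = ζ⁻¹ := by
    rw [Complex.inv_def, Complex.normSq_eq_norm_sq, hnorm]
    simp
  ext k l
  rw [Matrix.mul_apply]
  have hterm : ∀ j, dftMatrix n k j * star (dftMatrix n) j l =
      (n : ℂ)⁻¹ * (ζ ^ (k : ℕ) * (ζ ^ (l : ℕ))⁻¹) ^ (j : ℕ) := by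
    intro j
    rw [Matrix.star_apply, hF, hF, star_mul', star_pow, star_pow, hinv]
    have hs : ((1 / Real.sqrt n : ℝ) : ℂ) * star ((1 / Real.sqrt n : ℝ) : ℂ) = (n : ℂ)⁻¹ := by
      rw [Complex.star_def, Complex.conj_ofReal, ← Complex.ofReal_mul, div_mul_div_comm,
        Real.mul_self_sqrt (Nat.cast_nonneg n)]
      simp
    rw [mul_pow, ← hs, inv_pow]
    ring
  simp only [hterm]
  rw [← Finset.mul_sum, Fin.sum_univ_eq_sum_range
    (fun j => (ζ ^ (k : ℕ) * (ζ ^ (l : ℕ))⁻¹) ^ j)]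
  have hζ0 : ζ ≠ 0 := hprim.ne_zero hn
  rcases eq_or_ne k l with rfl | hkl
  · rw [mul_inv_cancel₀ (pow_ne_zero _ hζ0)]
    simp [hn']
  · rw [Matrix.one_apply_ne hkl]
    have hne : ζ ^ (k : ℕ) * (ζ ^ (l : ℕ))⁻¹ ≠ 1 := by
      intro h
      rw [← div_eq_mul_inv, div_eq_one_iff_eq (pow_ne_zero _ hζ0)] at h
      exact hkl (Fin.ext (hprim.pow_inj k.2 l.2 h))
    rw [geom_sum_eq hne, mul_pow, inv_pow, ← pow_mul, ← pow_mul, mul_comm (k : ℕ), mul_comm (l : ℕ),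
      pow_mul, pow_mul, hprim.pow_eq_one]
    simp

/-- The vector `F_n^* 1_{k} ⊗ v`: a discrete plane wave of momentum `θ_k` and polarization `v`. -/
noncomputable def planeWave (n : ℕ) (k : Fin n) (v : EuclideanSpace ℂ (Fin d)) : LocalSpace n d :=
  tensorVec (fun j => star (dftMatrix n k j)) v

lemma star_dft_single (k : Fin n) (v : EuclideanSpace ℂ (Fin d)) :
    star (tensorOp (dftMatrix n) (1 : Matrix (Fin d) (Fin d) ℂ)) (tensorVec (Pi.single k 1) v) =
      planeWave n k v := by
  rw [star_tensorOp, tensorOp_tensorVec, planeWave, star_one, map_one]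
  congr 1
  ext j
  simp

lemma dft_planeWave (hn : n ≠ 0) (k : Fin n) (v : EuclideanSpace ℂ (Fin d)) :
    tensorOp (dftMatrix n) (1 : Matrix (Fin d) (Fin d) ℂ) (planeWave n k v) =
      tensorVec (Pi.single k 1) v := by
  have h : tensorOp (dftMatrix n) (1 : Matrix (Fin d) (Fin d) ℂ) *
      star (tensorOp (dftMatrix n) (1 : Matrix (Fin d) (Fin d) ℂ)) = 1 := by
    rw [star_tensorOp, tensorOp_mul, dftMatrix_mul_star hn, star_one, one_mul, tensorOp_one]
  rw [← star_dft_single]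
  exact congrArg (fun B : LocalSpace n d →L[ℂ] LocalSpace n d => B _) h

lemma inner_planeWave (hn : n ≠ 0) (k l : Fin n) (v w : EuclideanSpace ℂ (Fin d)) :
    ⟪planeWave n k v, planeWave n l w⟫_ℂ = if k = l then ⟪v, w⟫_ℂ else 0 := by
  rw [planeWave, planeWave, inner_tensorVec]
  have h := congrFun (congrFun (dftMatrix_mul_star hn) k) l
  rw [Matrix.mul_apply, Matrix.one_apply] at h
  simp only [Matrix.star_apply] at h
  simp only [star_star]
  rw [h]
  split_ifs <;> simp

/-- The plane waves form an orthonormal basis of `ℓ²({0, …, n - 1}) ⊗ ℂ^d`. -/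
lemma exists_planeWave_basis (hn : n ≠ 0) (d : ℕ) :
    ∃ e : OrthonormalBasis (Fin n × Fin d) ℂ (LocalSpace n d),
      ∀ k, e k = planeWave n k.1 (EuclideanSpace.basisFun (Fin d) ℂ k.2) := by
  have hon : Orthonormal ℂ fun k : Fin n × Fin d =>
      planeWave n k.1 (EuclideanSpace.basisFun (Fin d) ℂ k.2) := by
    rw [orthonormal_iff_ite]
    rintro ⟨k, a⟩ ⟨l, b⟩
    rw [inner_planeWave hn, (EuclideanSpace.basisFun (Fin d) ℂ).inner_eq_ite]
    by_cases hkl : k = l <;> simp [hkl]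
  have hcard : Fintype.card (Fin n × Fin d) = Module.finrank ℂ (LocalSpace n d) := by
    rw [finrank_euclideanSpace]
    exact Fintype.card_congr toLex
  -- the criterion by cardinality needs a non-empty index type
  rcases Nat.eq_zero_or_pos d with rfl | hd
  · exact ⟨OrthonormalBasis.mk hon (by
      intro x _
      have : x = 0 := by ext i; exact (ofLex i).2.elim0
      rw [this]; exact zero_mem _), fun k => k.2.elim0⟩
  · have : Nonempty (Fin n × Fin d) := ⟨⟨⟨0, Nat.pos_of_ne_zero hn⟩, ⟨0, hd⟩⟩⟩
    refine ⟨OrthonormalBasis.mk hon ?_, fun k => by simp⟩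
    rw [hon.linearIndependent.span_eq_top_of_card_eq_finrank hcard]

variable {q r : Torus → SiteMatrix d} {μ ν δ : ℝ} {p : Fin n → SiteMatrix d}

open Classical in
/-- The indices `k` of the momenta `θ_k` in `[μ + δ, ν - δ]`. -/
noncomputable def windowIndices (μ ν δ : ℝ) (n : ℕ) : Finset (Fin n) :=
  {k | dftAngle n k ∈ Set.Icc (μ + δ) (ν - δ)}

/-- In the basis of plane waves the Fourier window is block diagonal. -/
lemma fourierWindow_planeWave (hn : n ≠ 0)
    (hp : ∀ k ∈ windowIndices μ ν δ n,
      posProjection (r (dftAngle n k : Torus) - q (dftAngle n k : Torus)) = p k)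
    (k : Fin n) (v : EuclideanSpace ℂ (Fin d)) :
    fourierWindow q r μ ν δ n (planeWave n k v) =
      if k ∈ windowIndices μ ν δ n then planeWave n k (p k v) else 0 := by
  classical
  rw [fourierWindow, ContinuousLinearMap.comp_apply, ContinuousLinearMap.comp_apply,
    dft_planeWave hn, sum_apply]
  have hterm : ∀ l ∈ windowIndices μ ν δ n, tensorOp (Matrix.single l l 1)
      ((Matrix.toEuclideanCLM (n := Fin d) (𝕜 := ℂ)).symm
        (posProjection (r (dftAngle n l : Torus) - q (dftAngle n l : Torus))))
      (tensorVec (Pi.single k 1) v) = if k = l then tensorVec (Pi.single k 1) (p k v) else 0 := by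
    intro l hl
    rw [tensorOp_tensorVec, hp l hl, StarAlgEquiv.apply_symm_apply, Matrix.mulVec_single_one]
    split_ifs with h
    · subst h
      congr 1
      ext j
      simp [Matrix.single_apply, Pi.single_apply, eq_comm]
    · ext i
      simp [tensorVec, Ne.symm h]
  have hsum : (∑ l with dftAngle n l ∈ Set.Icc (μ + δ) (ν - δ), tensorOp (Matrix.single l l 1)
      ((Matrix.toEuclideanCLM (n := Fin d) (𝕜 := ℂ)).symm
        (posProjection (r (dftAngle n l : Torus) - q (dftAngle n l : Torus))))
      (tensorVec (Pi.single k 1) v)) =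
      if k ∈ windowIndices μ ν δ n then tensorVec (Pi.single k 1) (p k v) else 0 := by
    refine (Finset.sum_congr (by ext; simp [windowIndices]) fun l _ => rfl).trans
      ((Finset.sum_congr rfl hterm).trans ?_)
    rw [Finset.sum_ite_eq]
  rw [hsum]
  split_ifs
  · exact star_dft_single k _
  · exact map_zero _

lemma isStarProjection_fourierWindow (hn : n ≠ 0)
    (hp : ∀ k ∈ windowIndices μ ν δ n,
      posProjection (r (dftAngle n k : Torus) - q (dftAngle n k : Torus)) = p k)
    (hproj : ∀ k ∈ windowIndices μ ν δ n, IsStarProjection (p k)) :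
    IsStarProjection (fourierWindow q r μ ν δ n) := by
  obtain ⟨e, he⟩ := exists_planeWave_basis hn d
  have hE := fourierWindow_planeWave hn hp
  refine ⟨?_, ?_⟩
  · refine ContinuousLinearMap.coe_injective (e.toBasis.ext fun k => ?_)
    rw [OrthonormalBasis.coe_toBasis, he]
    change fourierWindow q r μ ν δ n (fourierWindow q r μ ν δ n _) = fourierWindow q r μ ν δ n _
    rw [hE]
    split_ifs with h
    · rw [hE, if_pos h]
      congr 1
      exact congrArg (fun B : SiteMatrix d => B _) (hproj _ h).isIdempotentElem
    · exact map_zero _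
  · refine IsSelfAdjoint.adjoint_conj ?_ _
    rw [IsSelfAdjoint, star_sum]
    refine Finset.sum_congr rfl fun k _ => ?_
    have hpos : star (posProjection (r (dftAngle n k : Torus) - q (dftAngle n k : Torus))) =
        posProjection (r (dftAngle n k : Torus) - q (dftAngle n k : Torus)) :=
      isSelfAdjoint_starProjection _
    have hsymm : star ((Matrix.toEuclideanCLM (n := Fin d) (𝕜 := ℂ)).symm
        (posProjection (r (dftAngle n k : Torus) - q (dftAngle n k : Torus)))) =
        (Matrix.toEuclideanCLM (n := Fin d) (𝕜 := ℂ)).symm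
          (posProjection (r (dftAngle n k : Torus) - q (dftAngle n k : Torus))) := by
      have hinj : Function.Injective (Matrix.toEuclideanCLM (n := Fin d) (𝕜 := ℂ)) :=
        EquivLike.injective _
      apply hinj
      rw [map_star, StarAlgEquiv.apply_symm_apply, hpos]
    rw [star_tensorOp, hsymm, Matrix.star_eq_conjTranspose, Matrix.conjTranspose_single, star_one]

/-- Each momentum in the window contributes at least one dimension, as `p k ≠ 0`. -/
lemma card_windowIndices_le_finrank (hn : n ≠ 0)
    (hp : ∀ k ∈ windowIndices μ ν δ n,
      posProjection (r (dftAngle n k : Torus) - q (dftAngle n k : Torus)) = p k)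
    (hproj : ∀ k ∈ windowIndices μ ν δ n, IsStarProjection (p k) ∧ p k ≠ 0) :
    (windowIndices μ ν δ n).card ≤
      Module.finrank ℂ (LinearMap.range (fourierWindow q r μ ν δ n).toLinearMap) := by
  have hv : ∀ k : windowIndices μ ν δ n, ∃ v, p k v = v ∧ ‖v‖ = 1 := by
    intro k
    obtain ⟨hk, hk0⟩ := hproj k k.2
    obtain ⟨w, hw⟩ : ∃ w, p k w ≠ 0 := by
      by_contra! h
      exact hk0 (ContinuousLinearMap.ext h)
    refine ⟨((‖p k w‖⁻¹ : ℝ) : ℂ) • p k w, ?_, ?_⟩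
    · rw [map_smul]
      congr 1
      exact congrArg (fun B : SiteMatrix d => B w) hk.isIdempotentElem
    · rw [norm_smul, Complex.norm_real, norm_inv, norm_norm,
        inv_mul_cancel₀ (norm_ne_zero_iff.mpr hw)]
  choose v hv1 hv2 using hv
  have hrange : ∀ k : windowIndices μ ν δ n, planeWave n k (v k) ∈
      LinearMap.range (fourierWindow q r μ ν δ n).toLinearMap := by
    intro k
    refine ⟨planeWave n k (v k), ?_⟩
    change fourierWindow q r μ ν δ n _ = _
    rw [fourierWindow_planeWave hn hp, if_pos k.2, hv1]
  have hon : Orthonormal ℂ fun k : windowIndices μ ν δ n => planeWave n (k : Fin n) (v k) := by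
    rw [orthonormal_iff_ite]
    intro k l
    rw [inner_planeWave hn]
    by_cases hkl : k = l
    · subst hkl
      rw [if_pos rfl, if_pos rfl, inner_self_eq_norm_sq_to_K, hv2]
      simp
    · rw [if_neg hkl, if_neg fun h => hkl (Subtype.ext h)]
  have hli := hon.linearIndependent
  have hli' : LinearIndependent ℂ fun k : windowIndices μ ν δ n =>
      (⟨planeWave n k (v k), hrange k⟩ :
        LinearMap.range (fourierWindow q r μ ν δ n).toLinearMap) :=
    LinearIndependent.of_comp (Submodule.subtype _) hli
  have h := hli'.fintype_card_le_finrank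
  rwa [Fintype.card_coe] at h

/-- If the expectation of `A` in the plane waves with momentum `θ_k` and polarization in the range
of `p k` is at most `C / n`, then the trace of `A` over the range of the Fourier window is
bounded. -/
lemma sum_inner_fourierWindow_le (hn : n ≠ 0)
    (hp : ∀ k ∈ windowIndices μ ν δ n,
      posProjection (r (dftAngle n k : Torus) - q (dftAngle n k : Torus)) = p k)
    (hproj : ∀ k ∈ windowIndices μ ν δ n, IsStarProjection (p k))
    {e : OrthonormalBasis (Fin n × Fin d) ℂ (LocalSpace n d)}
    (he : ∀ k, e k = planeWave n k.1 (EuclideanSpace.basisFun (Fin d) ℂ k.2))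
    {A : LocalSpace n d →L[ℂ] LocalSpace n d} {C : ℝ} (hC : 0 ≤ C)
    (hA : ∀ k ∈ windowIndices μ ν δ n, ∀ v, p k v = v →
      (⟪planeWave n k v, A (planeWave n k v)⟫_ℂ).re ≤ C / n * ‖v‖ ^ 2) :
    ∑ k, (⟪fourierWindow q r μ ν δ n (e k), A (fourierWindow q r μ ν δ n (e k))⟫_ℂ).re ≤
      C * d := by
  have hterm : ∀ k, (⟪fourierWindow q r μ ν δ n (e k),
      A (fourierWindow q r μ ν δ n (e k))⟫_ℂ).re ≤ C / n := by
    rintro ⟨k, a⟩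
    rw [he, fourierWindow_planeWave hn hp]
    split_ifs with h
    · have hk := hproj _ h
      refine (hA k h _ (congrArg (fun B : SiteMatrix d => B _) hk.isIdempotentElem)).trans ?_
      have hn1 : ‖p k (EuclideanSpace.basisFun (Fin d) ℂ a)‖ ≤ 1 := by
        have h1 := (p k).le_of_opNorm_le hk.norm_le (EuclideanSpace.basisFun (Fin d) ℂ a)
        rwa [OrthonormalBasis.norm_eq_one, mul_one] at h1
      exact mul_le_of_le_one_right (by positivity) (pow_le_one₀ (norm_nonneg _) hn1)
    · simp only [inner_zero_left, Complex.zero_re]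
      positivity
  refine (Finset.sum_le_card_nsmul _ _ _ fun k _ => hterm k).trans (le_of_eq ?_)
  have hn' : (n : ℝ) ≠ 0 := by exact_mod_cast hn
  rw [Finset.card_univ, Fintype.card_prod, Fintype.card_fin, Fintype.card_fin, nsmul_eq_mul]
  push_cast
  field_simp

end Window

/-! ### Quadratic forms of translation-invariant operators -/

section Symbols

variable {d : ℕ} {q : Torus → SiteMatrix d} {Q : ChainSpace d →L[ℂ] ChainSpace d}

/-- The value at `x` of the Fourier transform of `f`. -/
noncomputable def fourierValue (f : ChainSpace d) (x : Torus) : EuclideanSpace ℂ (Fin d) :=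
  WithLp.toLp 2 fun a => chainFourier d f a x

lemma inner_eq_sum_integral (f g : ChainSpace d) :
    ⟪f, g⟫_ℂ = ∑ a, ∫ x, ⟪chainFourier d f a x, chainFourier d g a x⟫_ℂ ∂haarAddCircle := by
  rw [← (chainFourier d).inner_map_map, PiLp.inner_apply]
  exact Finset.sum_congr rfl fun a _ => L2.inner_def _ _

lemma inner_fourierValue (f g : ChainSpace d) (x : Torus) :
    ⟪fourierValue f x, fourierValue g x⟫_ℂ =
      ∑ a, ⟪chainFourier d f a x, chainFourier d g a x⟫_ℂ := by
  rw [PiLp.inner_apply]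
  rfl

lemma integrable_inner_fourierValue (f g : ChainSpace d) :
    Integrable (fun x => ⟪fourierValue f x, fourierValue g x⟫_ℂ) haarAddCircle := by
  simp only [inner_fourierValue]
  exact integrable_finsetSum _ fun a _ => L2.integrable_inner (chainFourier d f a) _

lemma IsSymbol.ae_fourierValue (hq : IsSymbol q Q) (f : ChainSpace d) :
    ∀ᵐ x ∂haarAddCircle, ⟪fourierValue f x, fourierValue (Q f) x⟫_ℂ =
      ⟪fourierValue f x, q x (fourierValue f x)⟫_ℂ := by
  filter_upwards [hq.fourier_apply f] with x hx
  exact congrArg (fun y => ⟪fourierValue f x, y⟫_ℂ) hx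

lemma IsSymbol.integrable_inner (hq : IsSymbol q Q) (f : ChainSpace d) :
    Integrable (fun x => ⟪fourierValue f x, q x (fourierValue f x)⟫_ℂ) haarAddCircle :=
  (integrable_inner_fourierValue f (Q f)).congr (hq.ae_fourierValue f)

lemma IsSymbol.inner_eq_integral (hq : IsSymbol q Q) (f : ChainSpace d) :
    ⟪f, Q f⟫_ℂ = ∫ x, ⟪fourierValue f x, q x (fourierValue f x)⟫_ℂ ∂haarAddCircle := by
  rw [← integral_congr_ae (hq.ae_fourierValue f), inner_eq_sum_integral]
  simp only [inner_fourierValue]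
  rw [integral_finsetSum]
  exact fun a _ => L2.integrable_inner (chainFourier d f a) _

lemma IsSymbol.one_sub (hq : IsSymbol q Q) : IsSymbol (fun x => 1 - q x) (1 - Q) := by
  refine ⟨(memLp_const _).sub hq.memLp, fun f => ?_⟩
  have h : ∀ a, ∀ᵐ x ∂haarAddCircle, chainFourier d ((1 - Q) f) a x =
      chainFourier d f a x - chainFourier d (Q f) a x := by
    intro a
    have e : chainFourier d ((1 - Q) f) a = chainFourier d f a - chainFourier d (Q f) a := by
      change chainFourier d (f - Q f) a = _
      rw [map_sub]
      rfl
    rw [e]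
    exact Lp.coeFn_sub _ _
  filter_upwards [hq.fourier_apply f, ae_all_iff.mpr h] with x hx hx'
  change _ = fourierValue f x - q x (fourierValue f x)
  rw [show q x (fourierValue f x) = _ from hx.symm]
  ext a
  exact hx' a

/-- Every vector field `1_A ⊗ v` on the torus is a Fourier transform. -/
lemma exists_fourierValue_indicator {A : Set Torus} (hA : MeasurableSet A)
    (v : EuclideanSpace ℂ (Fin d)) :
    ∃ f : ChainSpace d, ∀ᵐ x ∂haarAddCircle, fourierValue f x = A.indicator (fun _ => v) x := by
  refine ⟨(chainFourier d).symm (WithLp.toLp 2 fun a =>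
    indicatorConstLp 2 hA (measure_ne_top haarAddCircle A) (v a)), ?_⟩
  have h : ∀ a, ∀ᵐ x ∂haarAddCircle,
      indicatorConstLp 2 hA (measure_ne_top haarAddCircle A) (v a) x =
        A.indicator (fun _ => v a) x := fun a => indicatorConstLp_coeFn
  filter_upwards [ae_all_iff.mpr h] with x hx
  ext a
  rw [fourierValue]
  simp only [LinearIsometryEquiv.apply_symm_apply]
  rw [hx a]
  by_cases hxA : x ∈ A <;> simp [hxA]

lemma IsSymbol.ae_inner_nonneg (hq : IsSymbol q Q) (hQ : 0 ≤ Q) (v : EuclideanSpace ℂ (Fin d)) :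
    ∀ᵐ x ∂haarAddCircle, 0 ≤ (⟪v, q x v⟫_ℂ).re ∧ (⟪v, q x v⟫_ℂ).im = 0 := by
  have hpos := (ContinuousLinearMap.nonneg_iff_isPositive Q).mp hQ
  have hint : Integrable (fun x => ⟪v, q x v⟫_ℂ) haarAddCircle := by
    have h1 : Integrable q haarAddCircle := hq.memLp.integrable le_top
    have h2 : Integrable (fun x => q x v) haarAddCircle :=
      (ContinuousLinearMap.apply ℂ (EuclideanSpace ℂ (Fin d)) v).integrable_comp h1
    exact h2.const_inner v
  have hset : ∀ A, MeasurableSet A → 0 ≤ (∫ x in A, ⟪v, q x v⟫_ℂ ∂haarAddCircle).re ∧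
      (∫ x in A, ⟪v, q x v⟫_ℂ ∂haarAddCircle).im = 0 := by
    intro A hA
    obtain ⟨f, hf⟩ := exists_fourierValue_indicator hA v
    have h1 : ⟪f, Q f⟫_ℂ = ∫ x in A, ⟪v, q x v⟫_ℂ ∂haarAddCircle := by
      rw [hq.inner_eq_integral, ← integral_indicator hA]
      refine integral_congr_ae ?_
      filter_upwards [hf] with x hx
      rw [hx]
      by_cases hxA : x ∈ A <;> simp [hxA]
    have h2 := hpos.inner_nonneg_right f
    rw [h1] at h2
    obtain ⟨h3, h4⟩ := Complex.le_def.mp h2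
    exact ⟨h3, h4.symm⟩
  have hre : 0 ≤ᵐ[haarAddCircle] fun x => (⟪v, q x v⟫_ℂ).re := by
    refine ae_nonneg_of_forall_setIntegral_nonneg hint.re fun A hA _ => ?_
    have h : ∫ x in A, RCLike.re ⟪v, q x v⟫_ℂ ∂haarAddCircle =
        RCLike.re (∫ x in A, ⟪v, q x v⟫_ℂ ∂haarAddCircle) := integral_re hint.integrableOn
    exact h ▸ (hset A hA).1
  have him : (fun x => (⟪v, q x v⟫_ℂ).im) =ᵐ[haarAddCircle] 0 := by
    refine hint.im.ae_eq_zero_of_forall_setIntegral_eq_zero fun A hA _ => ?_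
    have h : ∫ x in A, RCLike.im ⟪v, q x v⟫_ℂ ∂haarAddCircle =
        RCLike.im (∫ x in A, ⟪v, q x v⟫_ℂ ∂haarAddCircle) := integral_im hint.integrableOn
    exact h.trans (hset A hA).2
  filter_upwards [hre, him] with x h1 h2 using ⟨h1, h2⟩

lemma nonneg_of_inner {T : SiteMatrix d}
    (h : ∀ v, 0 ≤ (⟪v, T v⟫_ℂ).re ∧ (⟪v, T v⟫_ℂ).im = 0) : 0 ≤ T := by
  rw [ContinuousLinearMap.nonneg_iff_isPositive, ContinuousLinearMap.isPositive_iff_complex]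
  intro v
  obtain ⟨h1, h2⟩ := h v
  have h3 : ⟪T v, v⟫_ℂ = starRingEnd ℂ ⟪v, T v⟫_ℂ := (inner_conj_symm _ _).symm
  have hre : (⟪T v, v⟫_ℂ).re = (⟪v, T v⟫_ℂ).re := by rw [h3, Complex.conj_re]
  have him : (⟪T v, v⟫_ℂ).im = 0 := by rw [h3, Complex.conj_im, h2, neg_zero]
  exact ⟨Complex.ext rfl him.symm, h1.trans_eq hre.symm⟩

/-- The symbol function of a positive operator is almost everywhere positive. -/
lemma IsSymbol.ae_nonneg (hq : IsSymbol q Q) (hQ : 0 ≤ Q) : ∀ᵐ x ∂haarAddCircle, 0 ≤ q x := by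
  have h := ae_all_iff.mpr fun i : ℕ =>
    hq.ae_inner_nonneg hQ (TopologicalSpace.denseSeq (EuclideanSpace ℂ (Fin d)) i)
  filter_upwards [h] with x hx
  refine nonneg_of_inner fun v => ?_
  have hclosed : IsClosed {v | 0 ≤ (⟪v, q x v⟫_ℂ).re ∧ (⟪v, q x v⟫_ℂ).im = 0} := by
    have hc : Continuous fun v => ⟪v, q x v⟫_ℂ := continuous_id.inner (q x).continuous
    exact (isClosed_le continuous_const (Complex.continuous_re.comp hc)).inter
      (isClosed_eq (Complex.continuous_im.comp hc) continuous_const)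
  have hd := (TopologicalSpace.denseRange_denseSeq (EuclideanSpace ℂ (Fin d)))
  exact hclosed.closure_subset_iff.mpr (Set.range_subset_iff.mpr hx) (hd v)

/-- Almost everywhere on the torus implies almost everywhere on an interval shorter than the
period. -/
lemma ae_restrict_of_ae_haar {P : Torus → Prop} (h : ∀ᵐ x ∂haarAddCircle, P x) {μ ν : ℝ}
    (hν : ν < μ + 2 * Real.pi) : ∀ᵐ x : ℝ ∂volume.restrict (Set.Icc μ ν), P (x : Torus) := by
  have h1 : ∀ᵐ x ∂(volume : Measure Torus), P x := by
    rw [volume_eq_smul_haarAddCircle]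
    exact Measure.ae_smul_measure h _
  have h2 := (AddCircle.measurePreserving_mk (2 * Real.pi) μ).quasiMeasurePreserving.ae h1
  rw [← restrict_Ioc_eq_restrict_Icc]
  exact ae_restrict_of_ae_restrict_of_subset (Set.Ioc_subset_Ioc_right hν.le) h2

/-- On an interval where the symbol function of a positive operator is continuous, it is positive
everywhere. -/
lemma IsSymbol.nonneg_of_continuousOn (hq : IsSymbol q Q) (hQ : 0 ≤ Q) {μ ν : ℝ} (hμν : μ < ν)
    (hν : ν < μ + 2 * Real.pi) (hc : ContinuousOn (fun x : ℝ => q (x : Torus)) (Set.Icc μ ν))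
    {x : ℝ} (hx : x ∈ Set.Icc μ ν) : 0 ≤ q (x : Torus) := by
  refine nonneg_of_inner fun v => ?_
  have hae := ae_restrict_of_ae_haar (hq.ae_inner_nonneg hQ v) hν
  have hcv : ContinuousOn (fun x : ℝ => ⟪v, q (x : Torus) v⟫_ℂ) (Set.Icc μ ν) :=
    continuousOn_const.inner (hc.clm_apply continuousOn_const)
  have hre : ContinuousOn (fun x : ℝ => (⟪v, q (x : Torus) v⟫_ℂ).re) (Set.Icc μ ν) :=
    Complex.continuous_re.comp_continuousOn hcv
  -- `0 ≤ u` is stated as `u = |u|`, as equalities extend from almost all points to all points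
  have h1 := Measure.eqOn_Icc_of_ae_eq volume hμν.ne
    (hae.mono fun x hx => (abs_of_nonneg hx.1).symm) hre hre.abs hx
  have h2 := Measure.eqOn_Icc_of_ae_eq volume hμν.ne (hae.mono fun x hx => hx.2)
    (Complex.continuous_im.comp_continuousOn hcv) continuousOn_const hx
  exact ⟨abs_eq_self.mp h1.symm, h2⟩

end Symbols

/-! ### Expectations in plane waves -/

section PlaneWave

variable {d : ℕ} {q : Torus → SiteMatrix d} {Q : ChainSpace d →L[ℂ] ChainSpace d}

lemma fourierBasis_repr_symm_single (j : ℤ) (z : ℂ) :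
    ∀ᵐ x ∂haarAddCircle, (fourierBasis (T := 2 * Real.pi)).repr.symm (lp.single 2 j z) x =
      z * fourier j x := by
  have h : (fourierBasis (T := 2 * Real.pi)).repr.symm (lp.single 2 j z) = z • fourierLp 2 j := by
    have h1 : (lp.single 2 j z : lp (fun _ : ℤ => ℂ) 2) = z • lp.single 2 j (1 : ℂ) := by
      rw [← lp.single_smul, smul_eq_mul, mul_one]
    rw [h1, map_smul, HilbertBasis.repr_symm_single, coe_fourierBasis]
  rw [h]
  filter_upwards [Lp.coeFn_smul z (fourierLp (T := 2 * Real.pi) 2 j), coeFn_fourierLp 2 j]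
    with x h1 h2
  rw [h1, Pi.smul_apply, h2, smul_eq_mul]

lemma star_dftMatrix {n : ℕ} (hn : n ≠ 0) (k j : Fin n) :
    star (dftMatrix n k j) =
      ((Real.sqrt n)⁻¹ : ℝ) * fourier (j : ℤ) (-(dftAngle n k : Torus)) := by
  rw [← AddCircle.coe_neg, fourier_coe_apply, dftMatrix, Matrix.of_apply, star_mul',
    Complex.star_def, Complex.conj_ofReal, ← Complex.exp_conj, one_div]
  congr 2
  have hπ : (Real.pi : ℂ) ≠ 0 := by exact_mod_cast Real.pi_ne_zero
  have hn' : (n : ℂ) ≠ 0 := by exact_mod_cast hn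
  simp only [map_mul, map_div₀, Complex.conj_I, Complex.conj_ofReal, map_natCast, map_ofNat,
    dftAngle]
  push_cast
  field_simp

/-- The Fourier transform of a plane wave is a normalized Dirichlet kernel. -/
lemma fourierValue_planeWave {n : ℕ} (hn : n ≠ 0) (k : Fin n) (v : EuclideanSpace ℂ (Fin d)) :
    ∀ᵐ x ∂haarAddCircle, fourierValue (localInclusion n d (planeWave n k v)) x =
      (((Real.sqrt n)⁻¹ : ℝ) * ∑ j ∈ Finset.range n,
        (fourier 1 (x - (dftAngle n k : Torus))) ^ j : ℂ) • v := by
  have h : ∀ (a : Fin d) (j : Fin n), ∀ᵐ x ∂haarAddCircle,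
      (fourierBasis (T := 2 * Real.pi)).repr.symm
        (lp.single 2 ((j : ℕ) : ℤ) (star (dftMatrix n k j) * v a)) x =
      star (dftMatrix n k j) * v a * fourier ((j : ℕ) : ℤ) x := fun a j =>
    fourierBasis_repr_symm_single _ _
  have hsum : ∀ a : Fin d, ∀ᵐ x ∂haarAddCircle,
      (∑ j : Fin n, (fourierBasis (T := 2 * Real.pi)).repr.symm
        (lp.single 2 ((j : ℕ) : ℤ) (star (dftMatrix n k j) * v a))) x =
      ∑ j : Fin n, star (dftMatrix n k j) * v a * fourier ((j : ℕ) : ℤ) x := by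
    intro a
    filter_upwards [Lp.coeFn_finsetSum Finset.univ (fun j : Fin n =>
      (fourierBasis (T := 2 * Real.pi)).repr.symm
        (lp.single 2 ((j : ℕ) : ℤ) (star (dftMatrix n k j) * v a))), ae_all_iff.mpr (h a)]
      with x h1 h2
    rw [h1, Finset.sum_apply]
    exact Finset.sum_congr rfl fun j _ => h2 j
  filter_upwards [ae_all_iff.mpr hsum] with x hx
  ext a
  have e : chainFourier d (localInclusion n d (planeWave n k v)) a =
      ∑ j : Fin n, (fourierBasis (T := 2 * Real.pi)).repr.symm
        (lp.single 2 ((j : ℕ) : ℤ) (star (dftMatrix n k j) * v a)) := by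
    rw [← map_sum]
    rfl
  change chainFourier d (localInclusion n d (planeWave n k v)) a x = _ * v a
  rw [e, hx a, Finset.mul_sum, Finset.sum_mul, Finset.sum_range]
  refine Finset.sum_congr rfl fun j _ => ?_
  rw [star_dftMatrix hn]
  have hpow : ∀ (m : ℕ) (y : Torus), (fourier (m : ℤ) y : ℂ) = (fourier 1 y) ^ m := by
    intro m y
    rw [fourier_apply, fourier_apply, one_smul, natCast_zsmul, AddCircle.toCircle_nsmul]
    simp
  rw [hpow, hpow, sub_eq_add_neg, fourier_one, fourier_one, fourier_one, AddCircle.toCircle_add,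
    Circle.coe_mul, mul_pow]
  ring

lemma inner_cutoff (Q : ChainSpace d →L[ℂ] ChainSpace d) (n : ℕ) (x y : LocalSpace n d) :
    ⟪x, cutoff Q n y⟫_ℂ = ⟪localInclusion n d x, Q (localInclusion n d y)⟫_ℂ := by
  rw [cutoff, ContinuousLinearMap.comp_apply, ContinuousLinearMap.adjoint_inner_right,
    ContinuousLinearMap.comp_apply]

/-- The zero of `1 - w` at `w = 1` compensates the growth of the Dirichlet kernel there. -/
lemma dirichletKernel_sq_mul_le {n : ℕ} (hn : n ≠ 0) {w : ℂ} (hw1 : ‖w‖ = 1) :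
    ‖((Real.sqrt n)⁻¹ : ℝ) * ∑ j ∈ Finset.range n, w ^ j‖ ^ 2 * ‖1 - w‖ ^ 2 ≤ 4 / n := by
  have hn' : (0 : ℝ) < n := by exact_mod_cast Nat.pos_of_ne_zero hn
  have e : (((Real.sqrt n)⁻¹ : ℝ) * ∑ j ∈ Finset.range n, w ^ j) * (1 - w) =
      ((Real.sqrt n)⁻¹ : ℝ) * (1 - w ^ n) := by
    rw [mul_assoc, geom_sum_mul_neg]
  have h3 : ‖1 - w ^ n‖ ≤ 2 := by
    refine (norm_sub_le _ _).trans ?_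
    rw [norm_pow, hw1, norm_one, one_pow]
    norm_num
  rw [← mul_pow, ← norm_mul, e, norm_mul, mul_pow, Complex.norm_real, Real.norm_eq_abs, sq_abs,
    inv_pow, Real.sq_sqrt hn'.le, ← div_eq_inv_mul]
  have h4 : ‖1 - w ^ n‖ ^ 2 ≤ 2 ^ 2 := pow_le_pow_left₀ (norm_nonneg _) h3 2
  gcongr
  linarith

lemma re_inner_smul_smul (g : ℂ) (v : EuclideanSpace ℂ (Fin d)) (T : SiteMatrix d) :
    (⟪g • v, T (g • v)⟫_ℂ).re = ‖g‖ ^ 2 * (⟪v, T v⟫_ℂ).re := by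
  rw [map_smul, inner_smul_left, inner_smul_right, ← mul_assoc,
    ← Complex.normSq_eq_conj_mul_self, Complex.normSq_eq_norm_sq, Complex.re_ofReal_mul]

/-- If the quadratic form of the symbol vanishes quadratically at `θ_k` in the direction `v`, then
the expectation in the plane wave is of order `1 / n`: the vanishing cancels the denominator of the
Dirichlet kernel. -/
lemma IsSymbol.inner_cutoff_planeWave_le (hq : IsSymbol q Q) {n : ℕ} (hn : n ≠ 0) (k : Fin n)
    (v : EuclideanSpace ℂ (Fin d)) {M : ℝ} (hM : 0 ≤ M)
    (h : ∀ᵐ x ∂haarAddCircle, (⟪v, q x v⟫_ℂ).re ≤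
      M * ‖1 - (fourier 1 (x - (dftAngle n k : Torus)) : ℂ)‖ ^ 2 * ‖v‖ ^ 2) :
    (⟪planeWave n k v, cutoff Q n (planeWave n k v)⟫_ℂ).re ≤ 4 * M / n * ‖v‖ ^ 2 := by
  rw [inner_cutoff, hq.inner_eq_integral]
  have hfx := fourierValue_planeWave hn k v
  generalize localInclusion n d (planeWave n k v) = f at hfx ⊢
  have hint := hq.integrable_inner f
  have h2 : (∫ x, ⟪fourierValue f x, q x (fourierValue f x)⟫_ℂ ∂haarAddCircle).re =
      ∫ x, (⟪fourierValue f x, q x (fourierValue f x)⟫_ℂ).re ∂haarAddCircle :=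
    (integral_re hint).symm
  rw [h2]
  have hle : ∀ᵐ x ∂haarAddCircle, (⟪fourierValue f x, q x (fourierValue f x)⟫_ℂ).re ≤
      4 * M / n * ‖v‖ ^ 2 := by
    filter_upwards [h, hfx] with x hx hfx
    rw [hfx, re_inner_smul_smul]
    have hw1 : ‖(fourier 1 (x - (dftAngle n k : Torus)) : ℂ)‖ = 1 := by
      rw [fourier_one]; exact Circle.norm_coe _
    have hgw := dirichletKernel_sq_mul_le hn hw1
    refine (mul_le_mul_of_nonneg_left hx (sq_nonneg _)).trans ?_
    have := mul_le_mul_of_nonneg_left hgw (mul_nonneg hM (sq_nonneg ‖v‖))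
    linear_combination this
  have h3 : ∫ x, (⟪fourierValue f x, q x (fourierValue f x)⟫_ℂ).re ∂haarAddCircle ≤
      ∫ _ : Torus, 4 * M / n * ‖v‖ ^ 2 ∂haarAddCircle :=
    integral_mono_ae hint.re (integrable_const _) hle
  refine h3.trans_eq ?_
  simp

lemma cutoff_one_sub (Q : ChainSpace d →L[ℂ] ChainSpace d) (n : ℕ) :
    cutoff (1 - Q) n = 1 - cutoff Q n := by
  ext1 x
  refine ext_inner_left ℂ fun y => ?_
  change ⟪y, ContinuousLinearMap.adjoint (localInclusion n d)
    (localInclusion n d x - Q (localInclusion n d x))⟫_ℂ =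
    ⟪y, x - ContinuousLinearMap.adjoint (localInclusion n d) (Q (localInclusion n d x))⟫_ℂ
  rw [map_sub, inner_sub_right, inner_sub_right, ContinuousLinearMap.adjoint_inner_right,
    inner_localInclusion]

end PlaneWave

/-! ### Quadratic vanishing of the symbol -/

section Pointwise

variable {d : ℕ}

/-- On angles at distance at least `δ` from `±2π`, the chord is comparable to the angle. -/
lemma abs_le_norm_one_sub_fourier {δ s : ℝ} (hδ : 0 < δ) (hδ2 : δ ≤ 2 * Real.pi)
    (hs : |s| ≤ 2 * Real.pi - δ) :
    δ / Real.pi ^ 2 * |s| ≤ ‖1 - (fourier 1 (s : Torus) : ℂ)‖ := by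
  have hπ := Real.pi_pos
  have hnorm : ‖1 - (fourier 1 (s : Torus) : ℂ)‖ = 2 * |Real.sin (s / 2)| := by
    have e : (fourier 1 (s : Torus) : ℂ) = Complex.exp (Complex.I * s) := by
      rw [fourier_coe_apply]
      congr 1
      have hπ' : (Real.pi : ℂ) ≠ 0 := by exact_mod_cast hπ.ne'
      push_cast
      field_simp
    rw [e, norm_sub_rev, Complex.norm_exp_I_mul_ofReal_sub_one, norm_mul, Real.norm_eq_abs,
      Real.norm_eq_abs, abs_two]
  have hsin : ∀ u : ℝ, 0 ≤ u → u ≤ Real.pi - δ / 2 → δ / Real.pi ^ 2 * u ≤ Real.sin u := by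
    intro u hu0 hu
    rcases le_total u (Real.pi / 2) with h | h
    · refine le_trans ?_ (Real.mul_le_sin hu0 h)
      refine mul_le_mul_of_nonneg_right ?_ hu0
      rw [div_le_div_iff₀ (by positivity) hπ]
      nlinarith
    · rw [← Real.sin_pi_sub]
      refine le_trans ?_ (Real.mul_le_sin (by linarith) (by linarith))
      have h1 : δ / Real.pi ^ 2 * u ≤ δ / Real.pi := by
        rw [div_mul_eq_mul_div, div_le_div_iff₀ (by positivity) hπ]
        nlinarith [mul_pos hδ hπ]
      refine h1.trans ?_
      rw [div_mul_eq_mul_div, div_le_div_iff_of_pos_right hπ]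
      linarith
  have habs : |Real.sin (s / 2)| = |Real.sin (|s| / 2)| := by
    rcases abs_choice s with h | h <;> rw [h]
    rw [neg_div, Real.sin_neg, abs_neg]
  have h2 := (hsin (|s| / 2) (by positivity) (by linarith)).trans (le_abs_self _)
  rw [hnorm, habs]
  linarith

lemma re_inner_le_norm_sq {T : SiteMatrix d} (h1 : T ≤ 1) (v : EuclideanSpace ℂ (Fin d)) :
    (⟪v, T v⟫_ℂ).re ≤ ‖v‖ ^ 2 := by
  have hpos1 : (1 - T).IsPositive := h1
  have h := hpos1.inner_nonneg_right v
  have e : ⟪v, (1 - T) v⟫_ℂ = ⟪v, v⟫_ℂ - ⟪v, T v⟫_ℂ := inner_sub_right _ _ _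
  rw [e, inner_self_eq_norm_sq_to_K] at h
  have h' := (Complex.le_def.mp h).1
  have h3 : ((‖v‖ : ℂ) ^ 2).re = ‖v‖ ^ 2 := by
    rw [← Complex.ofReal_pow, Complex.ofReal_re]
  simp only [Complex.zero_re, Complex.sub_re] at h'
  change 0 ≤ ((‖v‖ : ℂ) ^ 2).re - _ at h'
  linarith

/-- A positive contraction vanishing on the range of a projection `p` has a quadratic form bounded
by the squared distance to that range. -/
lemma re_inner_le_of_mul_eq_zero {T p : SiteMatrix d} (h0 : 0 ≤ T) (h1 : T ≤ 1) (hTp : T * p = 0)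
    (v : EuclideanSpace ℂ (Fin d)) : (⟪v, T v⟫_ℂ).re ≤ ‖v - p v‖ ^ 2 := by
  have hsym := ((ContinuousLinearMap.nonneg_iff_isPositive T).mp h0).isSymmetric
  have hz : T (p v) = 0 := congrArg (fun B : SiteMatrix d => B v) hTp
  have e1 : T (v - p v) = T v := by rw [map_sub, hz, sub_zero]
  have e2 : ⟪v - p v, T (v - p v)⟫_ℂ = ⟪v, T v⟫_ℂ := by
    have h3 : ⟪p v, T v⟫_ℂ = 0 := by
      have h4 : ⟪T (p v), v⟫_ℂ = ⟪p v, T v⟫_ℂ := hsym (p v) v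
      rw [← h4, hz, inner_zero_left]
    rw [e1, inner_sub_left, h3, sub_zero]
  rw [← e2]
  exact re_inner_le_norm_sq h1 _

/-- Let `a` be the symbol function of a positive contraction which vanishes, for `x ∈ [μ, ν]`, on
the range of a projection `p x`, with `p` Lipschitz continuous. Then the quadratic form of `a` in a
direction in the range of `p θ` vanishes quadratically at `θ`, uniformly in `θ ∈ [μ + δ, ν - δ]`. -/
lemma exists_quadratic_bound {a p : Torus → SiteMatrix d}
    (ha0 : ∀ᵐ x ∂haarAddCircle, 0 ≤ a x) (ha1 : ∀ᵐ x ∂haarAddCircle, a x ≤ 1)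
    {μ ν δ : ℝ} (hμ : 0 ≤ μ) (hν : ν < 2 * Real.pi) (hδ : 0 < δ)
    (hap : ∀ x ∈ Set.Icc μ ν, a (x : Torus) * p (x : Torus) = 0) {K : NNReal}
    (hpL : LipschitzOnWith K (fun x : ℝ => p (x : Torus)) (Set.Icc μ ν)) :
    ∃ M : ℝ, 0 ≤ M ∧ ∀ θ ∈ Set.Icc (μ + δ) (ν - δ), ∀ v, p (θ : Torus) v = v →
      ∀ᵐ x ∂haarAddCircle, (⟪v, a x v⟫_ℂ).re ≤
        M * ‖1 - (fourier 1 (x - (θ : Torus)) : ℂ)‖ ^ 2 * ‖v‖ ^ 2 := by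
  have hπ := Real.pi_pos
  refine ⟨(K ^ 2 + (δ ^ 2)⁻¹) * (Real.pi ^ 2 / δ) ^ 2, by positivity, ?_⟩
  intro θ hθ v hv
  filter_upwards [ha0, ha1] with x h0 h1
  set t : ℝ := (equivIco (2 * Real.pi) 0 x : ℝ) with ht
  have htx : (t : Torus) = x := AddCircle.coe_equivIco
  have htm : 0 ≤ t ∧ t < 0 + 2 * Real.pi := (equivIco (2 * Real.pi) 0 x).2
  rw [zero_add] at htm
  rw [← htx] at h0 h1 ⊢
  rw [← AddCircle.coe_sub]
  have hs : |t - θ| ≤ 2 * Real.pi - δ := by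
    rw [abs_le]
    constructor <;> linarith [hθ.1, hθ.2]
  have hnorm := abs_le_norm_one_sub_fourier hδ (by linarith [hθ.1, hθ.2]) hs
  have hdist : (⟪v, a (t : Torus) v⟫_ℂ).re ≤ (K ^ 2 + (δ ^ 2)⁻¹) * |t - θ| ^ 2 * ‖v‖ ^ 2 := by
    by_cases htI : t ∈ Set.Icc μ ν
    · have hθI : θ ∈ Set.Icc μ ν := ⟨by linarith [hθ.1], by linarith [hθ.2]⟩
      have h2 := re_inner_le_of_mul_eq_zero h0 h1 (hap t htI) v
      have h3 : ‖v - p (t : Torus) v‖ ≤ K * |t - θ| * ‖v‖ := by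
        have e : v - p (t : Torus) v = (p (θ : Torus) - p (t : Torus)) v := by
          nth_rewrite 1 [← hv]; rfl
        rw [e]
        refine (ContinuousLinearMap.le_opNorm _ _).trans ?_
        refine mul_le_mul_of_nonneg_right ?_ (norm_nonneg _)
        have h4 := hpL.dist_le_mul t htI θ hθI
        rwa [dist_comm, dist_eq_norm, Real.dist_eq] at h4
      calc (⟪v, a (t : Torus) v⟫_ℂ).re ≤ (K * |t - θ| * ‖v‖) ^ 2 :=
            h2.trans (pow_le_pow_left₀ (norm_nonneg _) h3 2)
        _ = K ^ 2 * |t - θ| ^ 2 * ‖v‖ ^ 2 := by ring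
        _ ≤ _ := by
          gcongr
          exact le_add_of_nonneg_right (by positivity)
    -- outside `[μ, ν]` the trivial bound suffices, as `θ` is at distance at least `δ`
    · have hδs : δ ≤ |t - θ| := by
        rw [Set.mem_Icc, not_and_or, not_le, not_le] at htI
        rcases htI with h | h
        · rw [abs_sub_comm]
          exact le_trans (by linarith [hθ.1]) (le_abs_self _)
        · exact le_trans (by linarith [hθ.2]) (le_abs_self _)
      have h5 : 1 ≤ (δ ^ 2)⁻¹ * |t - θ| ^ 2 := by
        rw [← div_eq_inv_mul, one_le_div (by positivity)]
        exact pow_le_pow_left₀ hδ.le hδs 2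
      calc (⟪v, a (t : Torus) v⟫_ℂ).re ≤ 1 * ‖v‖ ^ 2 := by
            rw [one_mul]; exact re_inner_le_norm_sq h1 v
        _ ≤ (δ ^ 2)⁻¹ * |t - θ| ^ 2 * ‖v‖ ^ 2 := by gcongr
        _ ≤ _ := by
          gcongr
          exact le_add_of_nonneg_left (by positivity)
  refine hdist.trans ?_
  have h6 : |t - θ| ≤ Real.pi ^ 2 / δ * ‖1 - (fourier 1 ((t - θ : ℝ) : Torus) : ℂ)‖ := by
    have := mul_le_mul_of_nonneg_left hnorm (a := Real.pi ^ 2 / δ) (by positivity)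
    refine le_trans (le_of_eq ?_) this
    field_simp
  have h7 := pow_le_pow_left₀ (abs_nonneg _) h6 2
  rw [mul_pow] at h7
  calc ((K : ℝ) ^ 2 + (δ ^ 2)⁻¹) * |t - θ| ^ 2 * ‖v‖ ^ 2
      ≤ (K ^ 2 + (δ ^ 2)⁻¹) * ((Real.pi ^ 2 / δ) ^ 2 *
          ‖1 - (fourier 1 ((t - θ : ℝ) : Torus) : ℂ)‖ ^ 2) * ‖v‖ ^ 2 := by gcongr
    _ = _ := by ring

lemma mul_eq_zero_swap {A : Type*} [Ring A] [StarRing A] {a b : A} (ha : IsSelfAdjoint a)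
    (hb : IsSelfAdjoint b) (h : a * b = 0) : b * a = 0 := by
  have h1 := congrArg star h
  rwa [star_mul, star_zero, ha.star_eq, hb.star_eq] at h1

/-- If `B ≥ 0` vanishes on the range of the projection `p`, then `p` is the projection
`{p - B > 0}`. -/
lemma posProjection_sub {p B : SiteMatrix d} (hp : IsStarProjection p) (hB : 0 ≤ B)
    (hBp : B * p = 0) : posProjection (p - B) = p := by
  have hpos := (ContinuousLinearMap.nonneg_iff_isPositive B).mp hB
  have hpp : ∀ v, p (p v) = p v := fun v =>
    congrArg (fun A : SiteMatrix d => A v) hp.isIdempotentElem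
  have hBpv : ∀ v, B (p v) = 0 := fun v => congrArg (fun A : SiteMatrix d => A v) hBp
  have hpB : p * B = 0 := mul_eq_zero_swap hpos.isSelfAdjoint hp.isSelfAdjoint hBp
  have hpBv : ∀ v, p (B v) = 0 := fun v => congrArg (fun A : SiteMatrix d => A v) hpB
  refine ContinuousLinearMap.IsStarProjection.ext isStarProjection_starProjection hp ?_
  rw [posProjection, Submodule.range_starProjection]
  refine le_antisymm (iSup_le fun a v hv => ?_) ?_
  · rw [Module.End.mem_eigenspace_iff] at hv
    have hv : p v - B v = ((a : ℝ) : ℂ) • v := hv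
    have ha : (0 : ℝ) < a := a.2
    have h1 : p v = ((a : ℝ) : ℂ) • p v := by
      have := congrArg p hv
      rwa [map_sub, hpp, hpBv, sub_zero, map_smul] at this
    -- the component `w` of `v` in the kernel of `p` satisfies `B w = -a w`, hence vanishes
    set w := v - p v with hw
    have h2 : B w = -(((a : ℝ) : ℂ) • w) := by
      have e : B w = B v := by rw [hw, map_sub, hBpv, sub_zero]
      rw [e, hw, smul_sub, ← h1, ← hv]
      abel
    have h3 := hpos.inner_nonneg_right w
    rw [h2, inner_neg_right, inner_smul_right, inner_self_eq_norm_sq_to_K] at h3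
    have h4 := (Complex.le_def.mp h3).1
    have h5 : (-(((a : ℝ) : ℂ) * (‖w‖ : ℂ) ^ 2)).re = -(a * ‖w‖ ^ 2) := by
      rw [← Complex.ofReal_pow, ← Complex.ofReal_mul, ← Complex.ofReal_neg, Complex.ofReal_re]
    have h6 : 0 ≤ -((a : ℝ) * ‖w‖ ^ 2) := h4.trans_eq h5
    have h7 : ‖w‖ ^ 2 = 0 := by
      have := sq_nonneg ‖w‖
      nlinarith
    have h8 : w = 0 := by simpa using h7
    exact ⟨v, (sub_eq_zero.mp h8).symm⟩
  · rintro _ ⟨v, rfl⟩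
    refine Submodule.mem_iSup_of_mem ⟨1, Set.mem_Ioi.mpr one_pos⟩ ?_
    rw [Module.End.mem_eigenspace_iff]
    change p (p v) - B (p v) = ((1 : ℝ) : ℂ) • p v
    rw [hpp, hBpv, sub_zero, Complex.ofReal_one, one_smul]

end Pointwise

/-! ### Asymptotics -/

section Asymptotics

/-- The window contains a positive fraction of the momenta. -/
lemma exists_le_card_windowIndices {μ ν δ : ℝ} (hμ : 0 ≤ μ) (hν : ν < 2 * Real.pi) (hδ : 0 < δ)
    (hδ2 : δ < (ν - μ) / 2) :
    ∃ c : ℝ, 0 < c ∧ ∀ᶠ n : ℕ in atTop, c * n ≤ (windowIndices μ ν δ n).card := by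
  have hπ := Real.pi_pos
  set α := (μ + δ) / (2 * Real.pi) with hα
  set β := (ν - δ) / (2 * Real.pi) with hβ
  have hαβ : 0 < β - α := by
    rw [hα, hβ, ← sub_div]
    exact div_pos (by linarith) (by positivity)
  have hα0 : 0 < α := div_pos (by linarith) (by positivity)
  have hβ1 : β < 1 := by
    rw [hβ, div_lt_one (by positivity)]
    linarith
  refine ⟨(β - α) / 2, by linarith, ?_⟩
  filter_upwards [eventually_ge_atTop (⌈2 / (β - α)⌉₊), eventually_gt_atTop 0] with n hn hn0
  have hn' : (0 : ℝ) < n := by exact_mod_cast hn0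
  have hnl : 2 / (β - α) ≤ n := Nat.ceil_le.mp hn
  have hsub : Finset.Icc ⌈n * α⌉₊ ⌊n * β⌋₊ ⊆ (windowIndices μ ν δ n).image Fin.val := by
    intro k hk
    rw [Finset.mem_Icc] at hk
    have h1 : n * α ≤ k := Nat.ceil_le.mp hk.1
    have h2 : (k : ℝ) ≤ n * β := (Nat.le_floor_iff (by nlinarith)).mp hk.2
    have hkn : k < n := by
      have : (k : ℝ) < n := by nlinarith
      exact_mod_cast this
    rw [Finset.mem_image]
    refine ⟨⟨k, hkn⟩, ?_, rfl⟩
    have hα' : α * (2 * Real.pi) = μ + δ := div_mul_cancel₀ _ (by positivity)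
    have hβ' : β * (2 * Real.pi) = ν - δ := div_mul_cancel₀ _ (by positivity)
    simp only [windowIndices, Finset.mem_filter, Finset.mem_univ, true_and, dftAngle, Set.mem_Icc]
    constructor
    · rw [le_div_iff₀ hn', ← hα']
      nlinarith
    · rw [div_le_iff₀ hn', ← hβ']
      nlinarith
  have hcard : (⌊n * β⌋₊ + 1 - ⌈n * α⌉₊ : ℕ) ≤ (windowIndices μ ν δ n).card := by
    rw [← Nat.card_Icc]
    exact (Finset.card_le_card hsub).trans Finset.card_image_le
  have h3 : (n * β : ℝ) < ⌊n * β⌋₊ + 1 := Nat.lt_floor_add_one _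
  have h4 : (⌈n * α⌉₊ : ℝ) < n * α + 1 := Nat.ceil_lt_add_one (by positivity)
  have h5 : (⌊n * β⌋₊ + 1 : ℝ) - ⌈n * α⌉₊ ≤ (windowIndices μ ν δ n).card := by
    have : ⌊n * β⌋₊ + 1 ≤ (windowIndices μ ν δ n).card + ⌈n * α⌉₊ := by omega
    have : (⌊n * β⌋₊ + 1 : ℝ) ≤ (windowIndices μ ν δ n).card + ⌈n * α⌉₊ := by exact_mod_cast this
    linarith
  rw [div_le_iff₀ hαβ] at hnl
  linarith

/-- Comparison of the Chernoff bound at `z = n` with `e^{-c n log n}`. -/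
lemma rpow_mul_exp_le {c C s m : ℝ} {n : ℕ} (hn : 1 ≤ n) (hm : c * n ≤ m) (hs : s ≤ C)
    (hC : 0 ≤ C) (hlog : C ≤ c / 4 * Real.log n) :
    (n : ℝ) ^ (-(m / 2)) * Real.exp ((n - 1) * s) ≤ Real.exp (-(c / 4 * n * Real.log n)) := by
  have hn1 : (1 : ℝ) ≤ n := by exact_mod_cast hn
  rw [Real.rpow_def_of_pos (by linarith), ← Real.exp_add, Real.exp_le_exp]
  have hl : 0 ≤ Real.log n := Real.log_nonneg hn1
  have h1 : (n - 1) * s ≤ n * C :=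
    (mul_le_mul_of_nonneg_left hs (by linarith)).trans (by nlinarith)
  have h2 : c * n * Real.log n ≤ m * Real.log n := mul_le_mul_of_nonneg_right hm hl
  have h3 : n * C ≤ n * (c / 4 * Real.log n) := mul_le_mul_of_nonneg_left hlog (by linarith)
  linarith

lemma tendsto_neg_log_div_top {f : ℕ → ℝ} {c : ℝ} (hc : 0 < c)
    (hf : ∀ᶠ n : ℕ in atTop, f n ≤ Real.exp (-(c * n * Real.log n))) :
    Tendsto (fun n : ℕ => (((1 / n : ℝ)) : EReal) * -ENNReal.log (ENNReal.ofReal (f n)))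
      atTop (𝓝 ⊤) := by
  rw [EReal.tendsto_nhds_top_iff_real]
  intro x
  have hlog : Tendsto (fun n : ℕ => c * Real.log n) atTop atTop :=
    (Real.tendsto_log_atTop.comp tendsto_natCast_atTop_atTop).const_mul_atTop hc
  filter_upwards [hf, hlog.eventually_gt_atTop x, eventually_gt_atTop 0] with n h1 h2 h3
  have hn : (n : ℝ) ≠ 0 := by exact_mod_cast h3.ne'
  have h4 : ((c * n * Real.log n : ℝ) : EReal) ≤ -ENNReal.log (ENNReal.ofReal (f n)) := by
    rw [EReal.le_neg, ← EReal.coe_neg]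
    refine (ENNReal.log_le_log (ENNReal.ofReal_le_ofReal h1)).trans_eq ?_
    rw [ENNReal.log_ofReal_of_pos (Real.exp_pos _), Real.log_exp]
  have h5 : (x : EReal) < ((1 / n * (c * n * Real.log n) : ℝ) : EReal) := by
    rw [EReal.coe_lt_coe_iff]
    have e : 1 / n * (c * n * Real.log n) = c * Real.log n := by field_simp
    rwa [e]
  refine h5.trans_le ?_
  rw [EReal.coe_mul]
  exact mul_le_mul_of_nonneg_left h4 (by exact_mod_cast (by positivity : (0 : ℝ) ≤ 1 / n))

lemma numberTest_nonneg_le_one {ι : Type*} [Fintype ι] [LinearOrder ι]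
    (P : EuclideanSpace ℂ ι →L[ℂ] EuclideanSpace ℂ ι) : 0 ≤ numberTest P ∧ numberTest P ≤ 1 := by
  have h : IsStarProjection (numberTest P) := isStarProjection_starProjection
  exact ⟨(ContinuousLinearMap.nonneg_iff_isPositive _).mpr
    (ContinuousLinearMap.IsPositive.of_isStarProjection h),
    ContinuousLinearMap.IsPositive.of_isStarProjection h.one_sub⟩

end Asymptotics

/-! ### The error bounds -/

section Main

variable {d : ℕ} {Q R : ChainSpace d →L[ℂ] ChainSpace d} {q r p : Torus → SiteMatrix d}

/-- The error bounds, in the form common to both cases of the theorem: on `[μ, ν]` there is a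
Lipschitz family of non-zero projections `p x` on whose ranges `q x` is `0` and `r x` is `1`. -/
lemma exists_error_bound (hQ0 : 0 ≤ Q) (hQ1 : Q ≤ 1) (hR0 : 0 ≤ R) (hR1 : R ≤ 1)
    (hq : IsSymbol q Q) (hr : IsSymbol r R) {μ ν : ℝ} (hμ : 0 ≤ μ) (hν : ν < 2 * Real.pi)
    (hpL : ∃ K : NNReal, LipschitzOnWith K (fun x : ℝ => p (x : Torus)) (Set.Icc μ ν))
    (hp : ∀ x ∈ Set.Icc μ ν, IsStarProjection (p (x : Torus)) ∧ p (x : Torus) ≠ 0)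
    (hqp : ∀ x ∈ Set.Icc μ ν, q (x : Torus) * p (x : Torus) = 0)
    (hrp : ∀ x ∈ Set.Icc μ ν, (1 - r (x : Torus)) * p (x : Torus) = 0)
    (hpos : ∀ x ∈ Set.Icc μ ν, posProjection (r (x : Torus) - q (x : Torus)) = p (x : Torus))
    {δ : ℝ} (hδ : δ ∈ Set.Ioo 0 ((ν - μ) / 2)) :
    ∃ c : ℝ, 0 < c ∧ ∀ᶠ n : ℕ in atTop,
      errZero (localDensity Q hQ0 hQ1 n) (numberTest (fourierWindow q r μ ν δ n)) ≤
        Real.exp (-(c * n * Real.log n)) ∧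
      errOne (localDensity R hR0 hR1 n) (numberTest (fourierWindow q r μ ν δ n)) ≤
        Real.exp (-(c * n * Real.log n)) := by
  obtain ⟨K, hK⟩ := hpL
  have hQ1' : 0 ≤ 1 - Q := sub_nonneg.mpr hQ1
  have hR1' : 0 ≤ 1 - R := sub_nonneg.mpr hR1
  have hq0 := hq.ae_nonneg hQ0
  have hq1 : ∀ᵐ x ∂haarAddCircle, q x ≤ 1 :=
    (hq.one_sub.ae_nonneg hQ1').mono fun x hx => sub_nonneg.mp hx
  have hr0 : ∀ᵐ x ∂haarAddCircle, 1 - r x ≤ 1 :=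
    (hr.ae_nonneg hR0).mono fun x hx => sub_le_self 1 hx
  have hr1 := hr.one_sub.ae_nonneg hR1'
  obtain ⟨M, hM0, hM⟩ := exists_quadratic_bound hq0 hq1 hμ hν hδ.1 hqp hK
  obtain ⟨M', hM0', hM'⟩ :=
    exists_quadratic_bound (a := fun x => 1 - r x) hr1 hr0 hμ hν hδ.1 hrp hK
  obtain ⟨c, hc, hcard⟩ := exists_le_card_windowIndices hμ hν hδ.1 hδ.2
  refine ⟨c / 4, by positivity, ?_⟩
  have hlog : Tendsto (fun n : ℕ => c / 4 * Real.log n) atTop atTop :=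
    (Real.tendsto_log_atTop.comp tendsto_natCast_atTop_atTop).const_mul_atTop (by positivity)
  filter_upwards [hcard, eventually_ge_atTop 1, hlog.eventually_ge_atTop (4 * M * d),
    hlog.eventually_ge_atTop (4 * M' * d)] with n hn hn1 hl hl'
  have hn0 : n ≠ 0 := by omega
  have hmem : ∀ k ∈ windowIndices μ ν δ n,
      dftAngle n k ∈ Set.Icc (μ + δ) (ν - δ) ∧ dftAngle n k ∈ Set.Icc μ ν := by
    intro k hk
    have h : dftAngle n k ∈ Set.Icc (μ + δ) (ν - δ) := by simpa [windowIndices] using hk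
    exact ⟨h, by linarith [h.1, hδ.1], by linarith [h.2, hδ.1]⟩
  set pn : Fin n → SiteMatrix d := fun k => p (dftAngle n k : Torus) with hpn
  have hp1 : ∀ k ∈ windowIndices μ ν δ n,
      posProjection (r (dftAngle n k : Torus) - q (dftAngle n k : Torus)) = pn k :=
    fun k hk => hpos _ (hmem k hk).2
  have hp2 : ∀ k ∈ windowIndices μ ν δ n, IsStarProjection (pn k) ∧ pn k ≠ 0 :=
    fun k hk => hp _ (hmem k hk).2
  have hp3 : ∀ k ∈ windowIndices μ ν δ n, IsStarProjection (pn k) := fun k hk => (hp2 k hk).1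
  have hproj := isStarProjection_fourierWindow hn0 hp1 hp3
  have hdim : c * n ≤ Module.finrank ℂ (LinearMap.range (fourierWindow q r μ ν δ n).toLinearMap) :=
    hn.trans (by exact_mod_cast card_windowIndices_le_finrank hn0 hp1 hp2)
  obtain ⟨e, he⟩ := exists_planeWave_basis hn0 d
  have hsQ := sum_inner_fourierWindow_le hn0 hp1 hp3 he (A := cutoff Q n) (C := 4 * M)
    (by positivity) fun k hk v hv =>
      hq.inner_cutoff_planeWave_le hn0 k v hM0 (hM _ (hmem k hk).1 v hv)
  have hsR := sum_inner_fourierWindow_le hn0 hp1 hp3 he (A := cutoff (1 - R) n) (C := 4 * M')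
    (by positivity) fun k hk v hv =>
      hr.one_sub.inner_cutoff_planeWave_le hn0 k v hM0' (hM' _ (hmem k hk).1 v hv)
  rw [cutoff_one_sub] at hsR
  have hz : (1 : ℝ) ≤ n := by exact_mod_cast hn1
  have hρ : ∀ {S : ChainSpace d →L[ℂ] ChainSpace d} (h0 : 0 ≤ S) (h1 : S ≤ 1),
      IsQuasiFreeDensity (cutoff S n) (localDensity S h0 h1 n) := fun h0 h1 =>
    (exists_isQuasiFreeDensity _ (cutoff_nonneg h0 n) (cutoff_le_one h1 n)).choose_spec
  have hQe := (numberTest_error_le hproj (cutoff_nonneg hQ0 n) (cutoff_le_one hQ1 n)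
    (hρ hQ0 hQ1) rfl e hz).1
  have hRe := (numberTest_error_le hproj (cutoff_nonneg hR0 n) (cutoff_le_one hR1 n)
    (hρ hR0 hR1) rfl e hz).2
  exact ⟨hQe.trans (rpow_mul_exp_le hn1 hdim hsQ (by positivity) hl),
    hRe.trans (rpow_mul_exp_le hn1 hdim hsR (by positivity) hl')⟩

end Main

theorem mainTheorem5 (d : ℕ) (Q R : ChainSpace d →L[ℂ] ChainSpace d)
    (hQ0 : 0 ≤ Q) (hQ1 : Q ≤ 1) (hR0 : 0 ≤ R) (hR1 : R ≤ 1)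
    (q r : Torus → SiteMatrix d) (hq : IsSymbol q Q) (hr : IsSymbol r R)
    (μ ν : ℝ) (hμ : 0 ≤ μ) (hμν : μ < ν) (hν : ν < 2 * Real.pi)
    (hqL : ∃ K : NNReal, LipschitzOnWith K (fun x : ℝ => q (x : Torus)) (Set.Icc μ ν))
    (hrL : ∃ K : NNReal, LipschitzOnWith K (fun x : ℝ => r (x : Torus)) (Set.Icc μ ν))
    (h : (∀ x ∈ Set.Icc μ ν, q (x : Torus) * r (x : Torus) = 0 ∧
            IsStarProjection (r (x : Torus)) ∧ r (x : Torus) ≠ 0) ∨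
         (∀ x ∈ Set.Icc μ ν, (1 - q (x : Torus)) * (1 - r (x : Torus)) = 0 ∧
            IsStarProjection (1 - q (x : Torus)) ∧ 1 - q (x : Torus) ≠ 0)) :
    (∀ δ ∈ Set.Ioo 0 ((ν - μ) / 2), ∃ c : ℝ, 0 < c ∧ ∀ᶠ n : ℕ in atTop,
      errZero (localDensity Q hQ0 hQ1 n) (numberTest (fourierWindow q r μ ν δ n)) ≤
        Real.exp (-(c * n * Real.log n)) ∧
      errOne (localDensity R hR0 hR1 n) (numberTest (fourierWindow q r μ ν δ n)) ≤
        Real.exp (-(c * n * Real.log n))) ∧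
    SuperExpDiscriminated (localDensity Q hQ0 hQ1) (localDensity R hR0 hR1) := by
  have hν' : ν < μ + 2 * Real.pi := by linarith
  have hmain : ∀ δ ∈ Set.Ioo 0 ((ν - μ) / 2), ∃ c : ℝ, 0 < c ∧ ∀ᶠ n : ℕ in atTop,
      errZero (localDensity Q hQ0 hQ1 n) (numberTest (fourierWindow q r μ ν δ n)) ≤
        Real.exp (-(c * n * Real.log n)) ∧
      errOne (localDensity R hR0 hR1 n) (numberTest (fourierWindow q r μ ν δ n)) ≤
        Real.exp (-(c * n * Real.log n)) := by
    intro δ hδ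
    rcases h with h | h
    · have hqpos : ∀ x ∈ Set.Icc μ ν, 0 ≤ q (x : Torus) := by
        obtain ⟨K, hK⟩ := hqL
        exact fun x hx => hq.nonneg_of_continuousOn hQ0 hμν hν' hK.continuousOn hx
      refine exists_error_bound (p := r) hQ0 hQ1 hR0 hR1 hq hr hμ hν hrL (fun x hx => (h x hx).2)
        (fun x hx => (h x hx).1) (fun x hx => ?_) (fun x hx => ?_) hδ
      · rw [sub_mul, one_mul, (h x hx).2.1.isIdempotentElem.eq, sub_self]
      · exact posProjection_sub (h x hx).2.1 (hqpos x hx) (h x hx).1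
    · have hrpos : ∀ x ∈ Set.Icc μ ν, 0 ≤ 1 - r (x : Torus) := by
        obtain ⟨K, hK⟩ := hrL
        exact fun x hx => hr.one_sub.nonneg_of_continuousOn (sub_nonneg.mpr hR1) hμν hν'
          (continuousOn_const.sub hK.continuousOn) hx
      have hrp : ∀ x ∈ Set.Icc μ ν, (1 - r (x : Torus)) * (1 - q (x : Torus)) = 0 := by
        intro x hx
        exact mul_eq_zero_swap (h x hx).2.1.isSelfAdjoint
          ((ContinuousLinearMap.nonneg_iff_isPositive _).mp (hrpos x hx)).isSelfAdjoint (h x hx).1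
      refine exists_error_bound (p := fun x => 1 - q x) hQ0 hQ1 hR0 hR1 hq hr hμ hν ?_
        (fun x hx => (h x hx).2) (fun x hx => ?_) hrp (fun x hx => ?_) hδ
      · obtain ⟨K, hK⟩ := hqL
        refine ⟨K, fun x hx y hy => ?_⟩
        rw [edist_sub_left]
        exact hK hx hy
      · have h1 := (h x hx).2.1.isIdempotentElem.eq
        rw [sub_mul, one_mul, sub_eq_self] at h1
        exact h1
      · have e : r (x : Torus) - q (x : Torus) =
            (1 - q (x : Torus)) - (1 - r (x : Torus)) := by abel
        rw [e]
        exact posProjection_sub (h x hx).2.1 (hrpos x hx) (hrp x hx)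
  refine ⟨hmain, ?_⟩
  obtain ⟨c, hc, hev⟩ := hmain ((ν - μ) / 4) ⟨by linarith, by linarith⟩
  exact ⟨fun n => numberTest (fourierWindow q r μ ν ((ν - μ) / 4) n),
    fun n => numberTest_nonneg_le_one _,
    tendsto_neg_log_div_top hc (hev.mono fun n hn => hn.1),
    tendsto_neg_log_div_top hc (hev.mono fun n hn => hn.2)⟩
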